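/- Let $k$ be a field and let $X=X_0\sqcup X_1$ be a well-ordered set, where the letters of $X_i$ have parity $i\in\mathbb Z/2$. Let $X^{**}$ be the set of all nonempty bracketed words (terms) over $X$, with parity $|\cdot|$ extended additively, and let $kX^{**}$ be the free non-associative $k$-algebra on $X$. The free Leibniz superalgebra $\mathrm{Lbs}(X)$ is the quotient of $kX^{**}$ by the ideal generated by all $\mu(\nu\tau)-(\mu\nu)\tau+(-1)^{|\nu||\tau|}(\mu\tau)\nu$ with $\mu,\nu,\tau\in X^{**}$ (if $X_1=\emptyset$, it is the free Leibniz algebra on $X$). Ideals are two-sided and are subspaces; an ideal $I$ is graded if it is the sum of its intersections with the parts of $\mathrm{Lbs}(X)$ of parity $0$ and $1$; $\mathrm{Id}(S)$ is the ideal generated by $S$. Write $[f_1\cdots f_n]_L=(\cdots((f_1f_2)f_3)\cdots)f_n$. The monomials $[a_1\cdots a_n]_L$ ($n\ge1$, $a_i\in X$) form a linear basis $\mathrm{NF}(X)$ of $\mathrm{Lbs}(X)$; let $\mathrm{supp}(f)$ be the set of the monomials that occur in $f$ with nonzero coefficient. Fix a map $\deg:X\to\mathbb Z_{>0}$, put $\deg[a_1\cdots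 a_n]_L=\sum_i\deg a_i$ and $\ell([a_1\cdots a_n]_L)=n$, and order $\mathrm{NF}(X)$ by comparing the tuples $(\deg\mu,\ell(\mu),a_1,\dots,a_n)$, for $\mu=[a_1\cdots a_n]_L$, lexicographically. For $f\ne0$ let $\bar f$ be the largest monomial of $f$; $f$ is monic if $\bar f$ has coefficient $1$, and homogeneous if all its monomials have the same parity. Let $S\subseteq\mathrm{Lbs}(X)$ be a (possibly empty) set of monic homogeneous elements. A normal $S$-polynomial built from $s\in S$ is an element $[s\,a_1\cdots a_m]_L$ with $m\ge0$ and $a_i\in X$ or, if $\ell(\bar s)=1$, an element $[a_1\cdots a_t\,s\,a_{t+1}\cdots a_m]_L$ with $1\le t\le m$ and $a_i\in X$. Let $\mathrm{Irr}(S)$ be the set of the monomials in $\mathrm{NF}(X)$ that are not the leading monomial of a normal $S$-polynomial. The set $S$ is a Gröbner–Shirshov basis if (i) for all $f\neq g$ in $S$ and every normal $S$-polynomial $h$ built from $g$ with $\bar h=\bar f$, the element $f-h$ is a linear combination of normal $S$-polynomials with leading monomials $<\bar f$; (ii) for all $f\in S$ with $\ell(\bar f)>1$ and all $\mu\in\mathrm{NF}(X)$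 with $\mu f\ne0$, the element $\mu f$ is a linear combination of normal $S$-polynomials whose leading monomials have degree $\le\deg\mu+\deg\bar f$. It is reduced if $\mathrm{supp}(s)\subseteq\mathrm{Irr}(S\setminus\{s\})$ for every $s\in S$, and it is a Gröbner–Shirshov basis for the ideal $I$ if moreover $I=\mathrm{Id}(S)$. **Theorem.** Every graded ideal $I$ of $\mathrm{Lbs}(X)$ has a unique reduced Gröbner–Shirshov basis. Consequently, if $S_I$ and $S_J$ are reduced Gröbner–Shirshov bases for graded ideals $I$ and $J$ of $\mathrm{Lbs}(X)$, then $I=J$ if and only if $S_I=S_J$. If $X_1=\emptyset$ (ordinary free Leibniz algebra), then every ideal is graded, so that every ideal has a unique reduced Gröbner–Shirshov basis. -/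

import Mathlib

/-!
# Free Leibniz superalgebras and their Gröbner-Shirshov bases

`k` is a field, `X` a set, `p : X → ZMod 2` the parity map (so `X₀` and `X₁` are the fibres of `p`
over `0` and `1`).
-/

namespace LeibnizGS

noncomputable section

/-! ## Ideals of non-associative algebras -/

section Ideals

variable {k A : Type*} [CommRing k] [NonUnitalNonAssocRing A] [Module k A]

/-- A subspace `I` of an algebra `A` is a (two-sided) ideal. -/
def IsIdeal (I : Submodule k A) : Prop :=
  ∀ x y : A, y ∈ I → x * y ∈ I ∧ y * x ∈ I

/-- The ideal `Id(S)` generated by a subset `S`: the smallest ideal containing `S`. -/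
def idealSpan (k : Type*) {A : Type*} [CommRing k] [NonUnitalNonAssocRing A] [Module k A]
    (S : Set A) : Submodule k A :=
  sInf {I : Submodule k A | IsIdeal I ∧ S ⊆ I}

theorem isIdeal_idealSpan (S : Set A) : IsIdeal (idealSpan k S) := by
  intro x y hy
  simp only [idealSpan, Submodule.mem_sInf, Set.mem_ofPred_eq] at hy ⊢
  exact ⟨fun I hI => (hI.1 x y (hy I hI)).1, fun I hI => (hI.1 x y (hy I hI)).2⟩

theorem subset_idealSpan (S : Set A) : S ⊆ idealSpan k S := by
  intro x hx
  simp only [idealSpan, SetLike.mem_coe, Submodule.mem_sInf, Set.mem_ofPred_eq]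
  exact fun I hI => hI.2 hx

theorem idealSpan_le {S : Set A} {I : Submodule k A} (hI : IsIdeal I) (hS : S ⊆ I) :
    idealSpan k S ≤ I :=
  sInf_le ⟨hI, hS⟩

end Ideals

/-! ## The free Leibniz superalgebra -/

section Free

variable (k : Type*) {X : Type*} [Field k] (p : X → ZMod 2)

/-- The sign `(-1)^{ij}` for parities `i`, `j`. -/
def sgn (i j : ZMod 2) : k := (-1) ^ (i * j).val

/-- The parity of a term (an element of the free magma `X**`). -/
def termParity : FreeMagma X → ZMod 2
  | .of x => p x
  | .mul μ ν => termParity μ + termParity ν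

/-- A term as an element of the free non-associative algebra `kX**`. -/
def term (μ : FreeMagma X) : FreeNonUnitalNonAssocAlgebra k X := MonoidAlgebra.single μ 1

theorem term_mul (μ ν : FreeMagma X) : term k (μ * ν) = term k μ * term k ν := by
  simp [term, MonoidAlgebra.single_mul_single]

/-- The set of the elements `μ(ντ) - (μν)τ + (-1)^{|ν||τ|} (μτ)ν` of `kX**`,
where `μ`, `ν`, `τ` are terms. -/
def leibnizRelations : Set (FreeNonUnitalNonAssocAlgebra k X) :=
  {f | ∃ μ ν τ : FreeMagma X,
    f = term k (μ * (ν * τ)) - term k ((μ * ν) * τ)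
      + sgn k (termParity p ν) (termParity p τ) • term k ((μ * τ) * ν)}

/-- The ideal of `kX**` generated by the Leibniz relations. -/
def leibnizIdeal : Submodule k (FreeNonUnitalNonAssocAlgebra k X) :=
  idealSpan k (leibnizRelations k p)

/-- The free Leibniz superalgebra `Lbs(X)` over `k`, where the letter `x` has parity `p x`. -/
def Lbs : Type _ := FreeNonUnitalNonAssocAlgebra k X ⧸ leibnizIdeal k p

namespace Lbs

instance : AddCommGroup (Lbs k p) :=
  inferInstanceAs (AddCommGroup (FreeNonUnitalNonAssocAlgebra k X ⧸ leibnizIdeal k p))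

instance : Module k (Lbs k p) :=
  inferInstanceAs (Module k (FreeNonUnitalNonAssocAlgebra k X ⧸ leibnizIdeal k p))

/-- The projection `kX** → Lbs(X)`. -/
def mk : FreeNonUnitalNonAssocAlgebra k X →ₗ[k] Lbs k p := (leibnizIdeal k p).mkQ

theorem mk_surjective : Function.Surjective (mk k p) := (leibnizIdeal k p).mkQ_surjective

theorem mk_eq_mk {f g : FreeNonUnitalNonAssocAlgebra k X} :
    mk k p f = mk k p g ↔ f - g ∈ leibnizIdeal k p :=
  Submodule.Quotient.eq _

/-- Multiplication of classes is induced by the multiplication of `kX**`. -/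
instance : Mul (Lbs k p) where
  mul := Quotient.map₂ (· * ·) (by
    intro a a' ha b b' hb
    change (leibnizIdeal k p).quotientRel _ _ at ha
    change (leibnizIdeal k p).quotientRel _ _ at hb
    change (leibnizIdeal k p).quotientRel _ _
    rw [Submodule.quotientRel_def] at ha hb ⊢
    have h : a * b - a' * b' = (a - a') * b + a' * (b - b') := by
      rw [sub_mul, mul_sub]; abel
    rw [h]
    exact add_mem (isIdeal_idealSpan _ b _ ha).2 (isIdeal_idealSpan _ a' _ hb).1)

theorem mk_mul (f g : FreeNonUnitalNonAssocAlgebra k X) :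
    mk k p (f * g) = mk k p f * mk k p g := rfl

instance : NonUnitalNonAssocRing (Lbs k p) where
  left_distrib a b c := by
    obtain ⟨a, rfl⟩ := mk_surjective k p a
    obtain ⟨b, rfl⟩ := mk_surjective k p b
    obtain ⟨c, rfl⟩ := mk_surjective k p c
    simp only [← map_add, ← mk_mul, mul_add]
  right_distrib a b c := by
    obtain ⟨a, rfl⟩ := mk_surjective k p a
    obtain ⟨b, rfl⟩ := mk_surjective k p b
    obtain ⟨c, rfl⟩ := mk_surjective k p c
    simp only [← map_add, ← mk_mul, add_mul]
  zero_mul a := by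
    obtain ⟨a, rfl⟩ := mk_surjective k p a
    rw [← map_zero (mk k p), ← mk_mul, zero_mul]
  mul_zero a := by
    obtain ⟨a, rfl⟩ := mk_surjective k p a
    rw [← map_zero (mk k p), ← mk_mul, mul_zero]

instance : IsScalarTower k (Lbs k p) (Lbs k p) where
  smul_assoc r a b := by
    obtain ⟨a, rfl⟩ := mk_surjective k p a
    obtain ⟨b, rfl⟩ := mk_surjective k p b
    simp only [smul_eq_mul, ← map_smul, ← mk_mul, smul_mul_assoc]

instance : SMulCommClass k (Lbs k p) (Lbs k p) where
  smul_comm r a b := by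
    obtain ⟨a, rfl⟩ := mk_surjective k p a
    obtain ⟨b, rfl⟩ := mk_surjective k p b
    simp only [smul_eq_mul, ← map_smul, ← mk_mul, mul_smul_comm]

/-- The image of a letter in `Lbs(X)`. -/
def ι (x : X) : Lbs k p := mk k p (term k (FreeMagma.of x))

/-- The homogeneous component of `Lbs(X)` of parity `i`, spanned by the images of the terms of
parity `i`. -/
def part (i : ZMod 2) : Submodule k (Lbs k p) :=
  Submodule.span k {f | ∃ μ : FreeMagma X, termParity p μ = i ∧ f = mk k p (term k μ)}

end Lbs

variable {k p}

/-- Right multiplication of `f` by letters: `[f a₁ ⋯ aₘ]_L = (⋯((f a₁) a₂) ⋯) aₘ`. -/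
def rmul (f : Lbs k p) (l : List X) : Lbs k p := l.foldl (fun g a => g * Lbs.ι k p a) f

variable (k p)

/-- The monomial `[u]_L = [a₁ ⋯ aₙ]_L` of `NF(X)` for a nonempty word `u = a₁ ⋯ aₙ`. -/
def nf (u : FreeSemigroup X) : Lbs k p := rmul (Lbs.ι k p u.head) u.tail

/-- The parity of a nonempty word. -/
def wordParity (u : FreeSemigroup X) : ZMod 2 := p u.head + (u.tail.map p).sum

end Free

/-! ## `NF(X)` is a linear basis of `Lbs(X)` -/

section NFBasis

variable (k : Type*) {X : Type*} [Field k] (p : X → ZMod 2)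

theorem word_induction {C : FreeSemigroup X → Prop} (h1 : ∀ x, C (FreeSemigroup.of x))
    (h2 : ∀ u a, C u → C (u * FreeSemigroup.of a)) (u : FreeSemigroup X) : C u := by
  obtain ⟨x, l⟩ := u
  induction l using List.reverseRecOn with
  | nil => exact h1 x
  | append_singleton l a ih => exact h2 ⟨x, l⟩ a ih

theorem nf_of (x : X) : nf k p (FreeSemigroup.of x) = Lbs.ι k p x := rfl

theorem nf_mul_of (u : FreeSemigroup X) (a : X) :
    nf k p (u * FreeSemigroup.of a) = nf k p u * Lbs.ι k p a := by
  simp [nf, rmul, FreeSemigroup.of]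

theorem wordParity_of (x : X) : wordParity p (FreeSemigroup.of x) = p x := by
  simp [wordParity, FreeSemigroup.of]

theorem wordParity_mul_of (u : FreeSemigroup X) (a : X) :
    wordParity p (u * FreeSemigroup.of a) = wordParity p u + p a := by
  simp [wordParity, FreeSemigroup.of, add_assoc]

/-! In this part `M` is a vector space with a basis `b` indexed by the nonempty words; it is made
into a Leibniz superalgebra with product `x · y = linR y x`, in which the left-normed product of
the letters of a word `u` is `b u`. This shows that the monomials `[u]_L` of `Lbs(X)` are linearly
independent. -/

section Model

variable {M : Type*} [AddCommGroup M] [Module k M]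

/-- The operator `BA - (-1)^{qr} AB`. -/
def br (q r : ZMod 2) (A B : Module.End k M) : Module.End k M :=
  B * A - sgn k q r • (A * B)

theorem br_add_left (q r : ZMod 2) (A A' B : Module.End k M) :
    br k q r (A + A') B = br k q r A B + br k q r A' B := by
  simp only [br, mul_add, add_mul, smul_add]; abel

theorem br_add_right (q r : ZMod 2) (A B B' : Module.End k M) :
    br k q r A (B + B') = br k q r A B + br k q r A B' := by
  simp only [br, mul_add, add_mul, smul_add]; abel

theorem br_smul_left (q r : ZMod 2) (c : k) (A B : Module.End k M) :
    br k q r (c • A) B = c • br k q r A B := by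
  simp only [br, mul_smul_comm, smul_mul_assoc, smul_sub]
  rw [smul_comm c]

theorem br_smul_right (q r : ZMod 2) (c : k) (A B : Module.End k M) :
    br k q r A (c • B) = c • br k q r A B := by
  simp only [br, mul_smul_comm, smul_mul_assoc, smul_sub]
  rw [smul_comm c]

theorem sgn_eq (q r : ZMod 2) : sgn k q r = if q = 1 ∧ r = 1 then -1 else 1 := by
  have h : ∀ q r : ZMod 2, (q * r).val = if q = 1 ∧ r = 1 then 1 else 0 := by decide
  rw [sgn, h]
  split_ifs <;> simp

theorem br_jacobi (q r s : ZMod 2) (A B C : Module.End k M) :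
    br k q (r + s) A (br k r s B C) =
      br k (q + r) s (br k q r A B) C - sgn k r s • br k (q + s) r (br k q s A C) B := by
  have h2 : (1 + 1 : ZMod 2) = 0 := rfl
  have hz : ∀ t : ZMod 2, t = 0 ∨ t = 1 := by decide
  rcases hz q with rfl | rfl <;> rcases hz r with rfl | rfl <;> rcases hz s with rfl | rfl <;>
    simp [br, sgn_eq, h2] <;> noncomm_ring

variable (b : Module.Basis (FreeSemigroup X) k M)

/-- Right multiplication by a letter. -/
def letR (a : X) : Module.End k M := b.constr k (fun u => b (u * FreeSemigroup.of a))

theorem letR_basis (a : X) (u : FreeSemigroup X) :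
    letR k b a (b u) = b (u * FreeSemigroup.of a) := by
  simp [letR]

/-- Right multiplication by a word, paired with the parity of that word. -/
def wordRAux (u : FreeSemigroup X) : Module.End k M × ZMod 2 :=
  u.tail.foldl (fun s a => (br k s.2 (p a) s.1 (letR k b a), s.2 + p a))
    (letR k b u.head, p u.head)

/-- Right multiplication by a word. -/
def wordR (u : FreeSemigroup X) : Module.End k M := (wordRAux k p b u).1

theorem wordRAux_snd (u : FreeSemigroup X) : (wordRAux k p b u).2 = wordParity p u := by
  induction u using word_induction with
  | h1 x => rw [wordParity_of]; rfl
  | h2 u a ih => rw [wordParity_mul_of, ← ih]; simp [wordRAux, FreeSemigroup.of]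

theorem wordR_of (x : X) : wordR k p b (FreeSemigroup.of x) = letR k b x := rfl

theorem wordR_mul_of (u : FreeSemigroup X) (a : X) :
    wordR k p b (u * FreeSemigroup.of a) =
      br k (wordParity p u) (p a) (wordR k p b u) (letR k b a) := by
  rw [← wordRAux_snd k p b u]
  simp [wordR, wordRAux, FreeSemigroup.of]

/-- Right multiplication by an element of `M`. -/
def linR : M →ₗ[k] Module.End k M := b.constr k (wordR k p b)

theorem linR_basis (u : FreeSemigroup X) : linR k p b (b u) = wordR k p b u := by
  simp [linR]

/-- The span of the words of parity `q`. -/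
def wpart (q : ZMod 2) : Submodule k M := Submodule.span k (b '' {u | wordParity p u = q})

theorem letR_mem (a : X) (q : ZMod 2) (y : M) (hy : y ∈ wpart k p b q) :
    letR k b a y ∈ wpart k p b (q + p a) := by
  induction hy using Submodule.span_induction with
  | mem x h =>
    obtain ⟨u, hu, rfl⟩ := h
    change wordParity p u = q at hu
    rw [letR_basis]
    refine Submodule.subset_span ⟨u * FreeSemigroup.of a, ?_, rfl⟩
    change wordParity p _ = _
    rw [wordParity_mul_of, hu]
  | zero => simp
  | add x y _ _ hx hy => rw [map_add]; exact add_mem hx hy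
  | smul c x _ hx => rw [map_smul]; exact Submodule.smul_mem _ _ hx

theorem wordR_mem (v : FreeSemigroup X) : ∀ (q : ZMod 2) (y : M),
    y ∈ wpart k p b q → wordR k p b v y ∈ wpart k p b (q + wordParity p v) := by
  induction v using word_induction with
  | h1 a =>
    intro q y hy
    rw [wordR_of, wordParity_of]
    exact letR_mem k p b a q y hy
  | h2 v a ih =>
    intro q y hy
    rw [wordR_mul_of, wordParity_mul_of]
    have h1 := letR_mem k p b a _ _ (ih q y hy)
    have h2 := ih _ _ (letR_mem k p b a q y hy)
    rw [add_assoc] at h1 h2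
    rw [add_comm (p a)] at h2
    exact sub_mem h1 (Submodule.smul_mem _ _ h2)

theorem linR_mem (q r : ZMod 2) (y z : M) (hy : y ∈ wpart k p b q) (hz : z ∈ wpart k p b r) :
    linR k p b z y ∈ wpart k p b (q + r) := by
  induction hz using Submodule.span_induction with
  | mem x h =>
    obtain ⟨u, hu, rfl⟩ := h
    change wordParity p u = r at hu
    subst hu
    rw [linR_basis]
    exact wordR_mem k p b u q y hy
  | zero => simp
  | add x y _ _ hx hy => rw [map_add]; exact add_mem hx hy
  | smul c x _ hx => rw [map_smul]; exact Submodule.smul_mem _ _ hx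

theorem linR_letR (a : X) (q : ZMod 2) (y : M) (hy : y ∈ wpart k p b q) :
    linR k p b (letR k b a y) = br k q (p a) (linR k p b y) (letR k b a) := by
  induction hy using Submodule.span_induction with
  | mem x h =>
    obtain ⟨u, hu, rfl⟩ := h
    change wordParity p u = q at hu
    subst hu
    rw [letR_basis, linR_basis, linR_basis, wordR_mul_of]
  | zero => simp [br]
  | add x y _ _ hx hy => rw [map_add, map_add, map_add, br_add_left, hx, hy]
  | smul c x _ hx => rw [map_smul, map_smul, map_smul, br_smul_left, hx]

theorem linR_wordR (v : FreeSemigroup X) : ∀ (q : ZMod 2) (y : M), y ∈ wpart k p b q →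
    linR k p b (wordR k p b v y) = br k q (wordParity p v) (linR k p b y) (wordR k p b v) := by
  induction v using word_induction with
  | h1 a =>
    intro q y hy
    rw [wordR_of, wordParity_of]
    exact linR_letR k p b a q y hy
  | h2 v a ih =>
    intro q y hy
    rw [wordR_mul_of, wordParity_mul_of, br_jacobi, ← ih q y hy, ← linR_letR k p b a q y hy,
      ← ih _ _ (letR_mem k p b a q y hy), ← linR_letR k p b a _ _ (wordR_mem k p b v q y hy),
      ← map_smul, ← map_sub]
    rfl

theorem linR_linR (q r : ZMod 2) (y z : M) (hy : y ∈ wpart k p b q) (hz : z ∈ wpart k p b r) :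
    linR k p b (linR k p b z y) = br k q r (linR k p b y) (linR k p b z) := by
  induction hz using Submodule.span_induction with
  | mem x h =>
    obtain ⟨u, hu, rfl⟩ := h
    change wordParity p u = r at hu
    subst hu
    rw [linR_basis, linR_wordR k p b u q y hy]
  | zero => simp [br]
  | add x y _ _ hx hy =>
    rw [map_add, LinearMap.add_apply, map_add, br_add_right, hx, hy]
  | smul c x _ hx =>
    rw [map_smul, LinearMap.smul_apply, map_smul, br_smul_right, hx]

/-- The value of a term in `M`. -/
def termVal : FreeMagma X → M
  | .of x => b (FreeSemigroup.of x)
  | .mul μ ν => linR k p b (termVal ν) (termVal μ)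

theorem termVal_mul (μ ν : FreeMagma X) :
    termVal k p b (μ * ν) = linR k p b (termVal k p b ν) (termVal k p b μ) := rfl

theorem termVal_mem (μ : FreeMagma X) : termVal k p b μ ∈ wpart k p b (termParity p μ) := by
  induction μ with
  | ih1 x => exact Submodule.subset_span ⟨FreeSemigroup.of x, wordParity_of p x, rfl⟩
  | ih2 μ ν hμ hν => exact linR_mem k p b _ _ _ _ hμ hν

/-- Linear extension of `termVal` to `kX**`. -/
def polyVal : FreeNonUnitalNonAssocAlgebra k X →ₗ[k] M :=
  Finsupp.linearCombination k (termVal k p b) ∘ₗ (MonoidAlgebra.coeffLinearEquiv k).toLinearMap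

theorem polyVal_single (μ : FreeMagma X) (c : k) :
    polyVal k p b (MonoidAlgebra.single μ c) = c • termVal k p b μ := by
  simp [polyVal]

theorem polyVal_term (μ : FreeMagma X) : polyVal k p b (term k μ) = termVal k p b μ := by
  rw [term, polyVal_single, one_smul]

theorem polyVal_mul (f g : FreeNonUnitalNonAssocAlgebra k X) :
    polyVal k p b (f * g) = linR k p b (polyVal k p b g) (polyVal k p b f) := by
  induction f using MonoidAlgebra.induction_linear with
  | zero => simp
  | add f₁ f₂ h₁ h₂ => rw [add_mul, map_add, map_add, h₁, h₂, map_add]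
  | single μ a =>
    induction g using MonoidAlgebra.induction_linear with
    | zero => simp
    | add g₁ g₂ h₁ h₂ => rw [mul_add, map_add, map_add, h₁, h₂, map_add, LinearMap.add_apply]
    | single ν c =>
      rw [MonoidAlgebra.single_mul_single, polyVal_single, polyVal_single, polyVal_single,
        termVal_mul, map_smul, map_smul, LinearMap.smul_apply, smul_smul]

theorem leibnizIdeal_le_ker : leibnizIdeal k p ≤ LinearMap.ker (polyVal k p b) := by
  refine idealSpan_le ?_ ?_
  · intro f g hg
    rw [LinearMap.mem_ker] at hg
    simp [LinearMap.mem_ker, polyVal_mul, hg]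
  · rintro f ⟨μ, ν, τ, rfl⟩
    rw [SetLike.mem_coe, LinearMap.mem_ker]
    simp only [map_add, map_sub, map_smul, polyVal_term, termVal_mul]
    rw [linR_linR k p b _ _ _ _ (termVal_mem k p b ν) (termVal_mem k p b τ)]
    simp [br]

/-- The linear map `Lbs(X) → M` sending `[u]_L` to `b u`. -/
def nfCoord : Lbs k p →ₗ[k] M :=
  (leibnizIdeal k p).liftQ (polyVal k p b) (leibnizIdeal_le_ker k p b)

theorem nfCoord_mk (f : FreeNonUnitalNonAssocAlgebra k X) :
    nfCoord k p b (Lbs.mk k p f) = polyVal k p b f := rfl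

theorem nfCoord_mul (f g : Lbs k p) :
    nfCoord k p b (f * g) = linR k p b (nfCoord k p b g) (nfCoord k p b f) := by
  obtain ⟨f, rfl⟩ := Lbs.mk_surjective k p f
  obtain ⟨g, rfl⟩ := Lbs.mk_surjective k p g
  rw [← Lbs.mk_mul, nfCoord_mk, nfCoord_mk, nfCoord_mk, polyVal_mul]

theorem nfCoord_ι (x : X) : nfCoord k p b (Lbs.ι k p x) = b (FreeSemigroup.of x) := by
  rw [Lbs.ι, nfCoord_mk, polyVal_term]; rfl

theorem nfCoord_nf (u : FreeSemigroup X) : nfCoord k p b (nf k p u) = b u := by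
  induction u using word_induction with
  | h1 x => rw [nf_of, nfCoord_ι]
  | h2 u a ih =>
    rw [nf_mul_of, nfCoord_mul, ih, nfCoord_ι, linR_basis, wordR_of, letR_basis]

end Model

theorem nf_linearIndependent : LinearIndependent k (nf k p) := by
  have h : (nfCoord k p Finsupp.basisSingleOne ∘ nf k p : FreeSemigroup X → _) =
      Finsupp.basisSingleOne (R := k) := funext (nfCoord_nf k p _)
  refine LinearIndependent.of_comp (nfCoord k p Finsupp.basisSingleOne) ?_
  rw [h]
  exact Module.Basis.linearIndependent _

theorem mul_mul_term (f : Lbs k p) (ν τ : FreeMagma X) :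
    f * (Lbs.mk k p (term k ν) * Lbs.mk k p (term k τ)) =
      (f * Lbs.mk k p (term k ν)) * Lbs.mk k p (term k τ)
      - sgn k (termParity p ν) (termParity p τ) •
        ((f * Lbs.mk k p (term k τ)) * Lbs.mk k p (term k ν)) := by
  obtain ⟨f, rfl⟩ := Lbs.mk_surjective k p f
  induction f using MonoidAlgebra.induction_linear with
  | zero => simp
  | add f g hf hg => rw [map_add]; simp only [add_mul, smul_add, hf, hg]; abel
  | single μ c =>
    have h : (MonoidAlgebra.single μ c : FreeNonUnitalNonAssocAlgebra k X) = c • term k μ := by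
      simp [term]
    have h1 : Lbs.mk k p (term k μ) * (Lbs.mk k p (term k ν) * Lbs.mk k p (term k τ)) =
        (Lbs.mk k p (term k μ) * Lbs.mk k p (term k ν)) * Lbs.mk k p (term k τ)
        - sgn k (termParity p ν) (termParity p τ) •
          ((Lbs.mk k p (term k μ) * Lbs.mk k p (term k τ)) * Lbs.mk k p (term k ν)) := by
      simp only [← Lbs.mk_mul, ← term_mul, ← map_smul, ← map_sub]
      rw [Lbs.mk_eq_mk]
      exact subset_idealSpan _ ⟨μ, ν, τ, by abel⟩
    rw [h, map_smul, smul_mul_assoc, h1, smul_sub, smul_comm c]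
    simp only [smul_mul_assoc]

theorem mul_term_mem (τ : FreeMagma X) : ∀ f : Lbs k p,
    f ∈ Submodule.span k (Set.range (nf k p)) →
      f * Lbs.mk k p (term k τ) ∈ Submodule.span k (Set.range (nf k p)) := by
  induction τ with
  | ih1 a =>
    intro f hf
    induction hf using Submodule.span_induction with
    | mem f h =>
      obtain ⟨u, rfl⟩ := h
      exact Submodule.subset_span ⟨u * FreeSemigroup.of a, nf_mul_of k p u a⟩
    | zero => simp
    | add f g _ _ hf hg => rw [add_mul]; exact add_mem hf hg
    | smul c f _ hf => rw [smul_mul_assoc]; exact Submodule.smul_mem _ _ hf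
  | ih2 ν τ hν hτ =>
    intro f hf
    rw [term_mul, Lbs.mk_mul, mul_mul_term]
    exact sub_mem (hτ _ (hν f hf)) (Submodule.smul_mem _ _ (hν _ (hτ f hf)))

theorem nf_span : (⊤ : Submodule k (Lbs k p)) ≤ Submodule.span k (Set.range (nf k p)) := by
  rintro f -
  obtain ⟨f, rfl⟩ := Lbs.mk_surjective k p f
  induction f using MonoidAlgebra.induction_linear with
  | zero => simp
  | add f g hf hg => rw [map_add]; exact add_mem hf hg
  | single μ c =>
    have h : (MonoidAlgebra.single μ c : FreeNonUnitalNonAssocAlgebra k X) = c • term k μ := by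
      simp [term]
    rw [h, map_smul]
    refine Submodule.smul_mem _ _ ?_
    induction μ with
    | ih1 x => exact Submodule.subset_span ⟨FreeSemigroup.of x, rfl⟩
    | ih2 μ ν hμ hν =>
      rw [term_mul, Lbs.mk_mul]
      exact mul_term_mem k p ν _ (hμ (by simp [term]))

/-- The linear basis `NF(X) = {[u]_L}` of `Lbs(X)`, indexed by the nonempty words `u`. -/
def nfBasis : Module.Basis (FreeSemigroup X) k (Lbs k p) :=
  Module.Basis.mk (nf_linearIndependent k p) (nf_span k p)

end NFBasis

/-! ## Gröbner-Shirshov bases -/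

section GroebnerShirshov

variable {k X : Type*} [Field k] [LinearOrder X] {p : X → ZMod 2}

/-- The degree of a nonempty word, for a degree map `deg` on the letters. -/
def wordDeg (deg : X → ℕ) (u : FreeSemigroup X) : ℕ := deg u.head + (u.tail.map deg).sum

/-- The deg-length-lex order: `(deg u, ℓ(u), a₁, …, aₙ) < (deg v, ℓ(v), b₁, …, bₘ)`
lexicographically, where `u = a₁ ⋯ aₙ` and `v = b₁ ⋯ bₘ`. -/
def WordLT (deg : X → ℕ) (u v : FreeSemigroup X) : Prop :=
  wordDeg deg u < wordDeg deg v ∨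
    (wordDeg deg u = wordDeg deg v ∧
      (u.length < v.length ∨
        (u.length = v.length ∧ List.Lex (· < ·) (u.head :: u.tail) (v.head :: v.tail))))

/-- The set of the words `u` such that `[u]_L` occurs in `f` with nonzero coefficient. -/
def supp (f : Lbs k p) : Finset (FreeSemigroup X) := ((nfBasis k p).repr f).support

/-- `[w]_L` is the leading monomial of `f`. -/
def IsLeading (deg : X → ℕ) (f : Lbs k p) (w : FreeSemigroup X) : Prop :=
  w ∈ supp f ∧ ∀ v ∈ supp f, v ≠ w → WordLT deg v w

/-- `f` is nonzero and its leading monomial has coefficient `1`. -/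
def IsMonic (deg : X → ℕ) (f : Lbs k p) : Prop :=
  ∃ w, IsLeading deg f w ∧ (nfBasis k p).repr f w = 1

/-- `f` is homogeneous: all the monomials of `f` have the same parity. -/
def IsHomogeneous (f : Lbs k p) : Prop :=
  (∀ w ∈ supp f, wordParity p w = 0) ∨ (∀ w ∈ supp f, wordParity p w = 1)

/-- A graded ideal of `Lbs(X)`. -/
def IsGradedIdeal (I : Submodule k (Lbs k p)) : Prop :=
  IsIdeal I ∧ I = (I ⊓ Lbs.part k p 0) ⊔ (I ⊓ Lbs.part k p 1)

/-- `h` is a normal `S`-polynomial built from `s`: either `h = [s a₁ ⋯ aₘ]_L` with `m ≥ 0`, or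
`h = [a₁ ⋯ aₜ s aₜ₊₁ ⋯ aₘ]_L` with `1 ≤ t ≤ m` and the leading monomial of `s` is a letter. -/
def IsNormalOf (deg : X → ℕ) (s h : Lbs k p) : Prop :=
  (∃ l : List X, h = rmul s l) ∨
    ((∃ w, IsLeading deg s w ∧ w.length = 1) ∧
      ∃ (u : FreeSemigroup X) (l : List X), h = rmul (nf k p u * s) l)

/-- `h` is a normal `S`-polynomial. -/
def IsNormal (deg : X → ℕ) (S : Set (Lbs k p)) (h : Lbs k p) : Prop :=
  ∃ s ∈ S, IsNormalOf deg s h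

/-- `Irr(S)`: the words `u` such that `[u]_L` is not the leading monomial of any normal
`S`-polynomial. -/
def Irr (deg : X → ℕ) (S : Set (Lbs k p)) : Set (FreeSemigroup X) :=
  {u | ∀ h, IsNormal deg S h → ¬ IsLeading deg h u}

/-- `f` is trivial modulo `(S, w)`: a linear combination of normal `S`-polynomials whose leading
monomials are smaller than `w`. -/
def TrivialModWord (deg : X → ℕ) (S : Set (Lbs k p)) (w : FreeSemigroup X) (f : Lbs k p) : Prop :=
  f ∈ Submodule.span k {h | IsNormal deg S h ∧ ∃ v, IsLeading deg h v ∧ WordLT deg v w}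

/-- `f` is trivial modulo `(S, n)`: a linear combination of normal `S`-polynomials whose leading
monomials have degree at most `n`. -/
def TrivialModDeg (deg : X → ℕ) (S : Set (Lbs k p)) (n : ℕ) (f : Lbs k p) : Prop :=
  f ∈ Submodule.span k {h | IsNormal deg S h ∧ ∃ v, IsLeading deg h v ∧ wordDeg deg v ≤ n}

/-- `S` is a Gröbner-Shirshov basis in `Lbs(X)`: a set of monic homogeneous elements such that
every inclusion composition `f - h` (where `h` is a normal `S`-polynomial built from some
`g ∈ S`, `g ≠ f`, with the same leading monomial `w` as `f`) is trivial modulo `(S, w)`, and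
every left multiplication composition `[u]_L f ≠ 0` (where the leading monomial `w` of `f ∈ S` has
length at least `2`) is trivial modulo `(S, deg u + deg w)`. The empty set is allowed. -/
structure IsGSBasis (deg : X → ℕ) (S : Set (Lbs k p)) : Prop where
  monic : ∀ f ∈ S, IsMonic deg f
  homogeneous : ∀ f ∈ S, IsHomogeneous f
  inclusion : ∀ f ∈ S, ∀ g ∈ S, f ≠ g → ∀ h w, IsNormalOf deg g h →
    IsLeading deg f w → IsLeading deg h w → TrivialModWord deg S w (f - h)
  leftMul : ∀ f ∈ S, ∀ w, IsLeading deg f w → 1 < w.length → ∀ u : FreeSemigroup X,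
    nf k p u * f ≠ 0 → TrivialModDeg deg S (wordDeg deg u + wordDeg deg w) (nf k p u * f)

/-- `S` is a reduced Gröbner-Shirshov basis: the monomials of each `s ∈ S` lie in `Irr(S ∖ {s})`. -/
def IsReducedGSBasis (deg : X → ℕ) (S : Set (Lbs k p)) : Prop :=
  IsGSBasis deg S ∧ ∀ s ∈ S, (supp s : Set (FreeSemigroup X)) ⊆ Irr deg (S \ {s})

/-- `S` is a reduced Gröbner-Shirshov basis for the ideal `I = Id(S)`. -/
def IsReducedGSBasisFor (deg : X → ℕ) (S : Set (Lbs k p)) (I : Submodule k (Lbs k p)) : Prop :=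
  I = idealSpan k S ∧ IsReducedGSBasis deg S

end GroebnerShirshov

end

end LeibnizGS

/-! For an ideal `I`, call a word leading if it is the leading word of an element of `I`. Since the
word order is well-founded, division with remainder shows that every leading word `w` is the leading
word of an element `w + r` of `I` in which no word of `r` is leading. This element is unique,
because a difference of two such elements lies in `I` and contains no leading word.

Call a leading word minimal if it is neither a proper right extension of a leading word nor contains
a leading letter after the first position; these are the two ways in which normal polynomials
produce leading words. The candidate basis `reducedSet` consists of the elements `w + r` with `w`
minimal.

Existence. Every leading word comes from a minimal one, so subtracting normal polynomials writes
each `f ∈ I` as a combination of normal polynomials with leading words at most that of `f`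
(`mem_normalSpan_reducedSet`). Compositions lie in `I` and obey the right bounds, hence are trivial.
Gradedness makes the elements homogeneous: the projection of `w + r` to the parity of `w` has the
same shape, so it equals `w + r`.

Uniqueness. This rests on the composition-diamond lemma `exists_normal_of_mem_idealSpan`: for a
Gröbner-Shirshov basis `S`, leading words of `Id(S)` are leading words of normal `S`-polynomials.
Normal polynomials span an ideal, and two of them with equal leading words differ by a combination
of smaller ones (`normal_sub_normal_mem`). Left multiplication controls only the degree, but this
suffices: a word below a letter is again a letter or has smaller degree. If `S` is reduced, its
elements then have minimal leading words and remainders free of leading words, and every minimal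
word occurs, so `S` is `reducedSet` of its ideal. -/

namespace LeibnizGS

noncomputable section

/-! ## The order on words -/

section Words

variable {X : Type*}

/-- The word `u a₁ ⋯ aₘ`. -/
def wapp (u : FreeSemigroup X) (l : List X) : FreeSemigroup X := ⟨u.head, u.tail ++ l⟩

/-- The letters of a nonempty word. -/
def letters (u : FreeSemigroup X) : List X := u.head :: u.tail

theorem letters_injective : Function.Injective (letters (X := X)) := by
  rintro ⟨a, l⟩ ⟨b, m⟩ h
  simpa [letters] using h

theorem letters_wapp (u : FreeSemigroup X) (l : List X) :
    letters (wapp u l) = letters u ++ l := rfl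

theorem letters_mul (u v : FreeSemigroup X) : letters (u * v) = letters u ++ letters v := by
  simp [letters]

theorem letters_of (x : X) : letters (FreeSemigroup.of x) = [x] := rfl

theorem length_letters (u : FreeSemigroup X) : (letters u).length = u.length := rfl

theorem length_wapp (u : FreeSemigroup X) (l : List X) :
    (wapp u l).length = u.length + l.length := by
  simp [← length_letters, letters_wapp]

theorem wapp_nil (u : FreeSemigroup X) : wapp u [] = u := by
  apply letters_injective; simp [letters_wapp]

theorem wapp_wapp (u : FreeSemigroup X) (l m : List X) :
    wapp (wapp u l) m = wapp u (l ++ m) := by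
  apply letters_injective; simp [letters_wapp]

theorem wapp_singleton (u : FreeSemigroup X) (a : X) :
    wapp u [a] = u * FreeSemigroup.of a := by
  apply letters_injective; simp [letters_wapp, letters_mul, letters_of]

theorem wapp_right_injective (u : FreeSemigroup X) : Function.Injective (wapp u) := by
  intro l m h
  simpa [letters_wapp] using congrArg letters h

theorem mul_of_inj {u v : FreeSemigroup X} {x y : X}
    (h : u * FreeSemigroup.of x = v * FreeSemigroup.of y) : u = v ∧ x = y := by
  have h1 := congrArg letters h
  simp only [letters_mul, letters_of] at h1
  obtain ⟨h2, h3⟩ := List.append_inj' h1 rfl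
  exact ⟨letters_injective h2, by simpa using h3⟩

/-- If `u l = v m` then one of the words `u`, `v` is a prefix of the other. -/
theorem wapp_eq_wapp {u v : FreeSemigroup X} {l m : List X} (h : wapp u l = wapp v m) :
    (∃ n, v = wapp u n ∧ l = n ++ m) ∨ ∃ n, u = wapp v n ∧ m = n ++ l := by
  have h1 := congrArg letters h
  simp only [letters_wapp] at h1
  rcases List.append_eq_append_iff.1 h1 with ⟨n, h2, h3⟩ | ⟨n, h2, h3⟩
  · exact Or.inl ⟨n, letters_injective (by rw [h2, letters_wapp]), h3⟩
  · exact Or.inr ⟨n, letters_injective (by rw [h2, letters_wapp]), h3⟩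

theorem eq_of_of_length_eq_one {u : FreeSemigroup X} (h : u.length = 1) :
    ∃ x, u = FreeSemigroup.of x := by
  obtain ⟨a, l⟩ := u
  have : l = [] := by simpa [FreeSemigroup.length] using h
  subst this
  exact ⟨a, rfl⟩

theorem one_le_length (u : FreeSemigroup X) : 1 ≤ u.length := Nat.le_add_left 1 _

theorem length_of (x : X) : (FreeSemigroup.of x).length = 1 := rfl

variable (deg : X → ℕ)

theorem wordDeg_eq (u : FreeSemigroup X) : wordDeg deg u = ((letters u).map deg).sum := by
  simp [wordDeg, letters]

theorem wordDeg_wapp (u : FreeSemigroup X) (l : List X) :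
    wordDeg deg (wapp u l) = wordDeg deg u + (l.map deg).sum := by
  simp [wordDeg_eq, letters_wapp]

theorem wordDeg_mul (u v : FreeSemigroup X) :
    wordDeg deg (u * v) = wordDeg deg u + wordDeg deg v := by
  simp [wordDeg_eq, letters_mul]

theorem wordDeg_of (x : X) : wordDeg deg (FreeSemigroup.of x) = deg x := by
  simp [wordDeg_eq, letters_of]

/-- The tuple by which words are compared. -/
def wordKey (u : FreeSemigroup X) : ℕ ×ₗ ℕ ×ₗ List X :=
  toLex (wordDeg deg u, toLex (u.length, letters u))

variable {deg}

theorem wordKey_injective : Function.Injective (wordKey (X := X) deg) := by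
  intro u v h
  apply letters_injective
  simp only [wordKey, toLex_inj, Prod.mk.injEq] at h
  exact h.2.2

section Order

variable [LinearOrder X]

theorem wordLT_iff {u v : FreeSemigroup X} :
    WordLT deg u v ↔ wordKey deg u < wordKey deg v := by
  simp only [wordKey, Prod.Lex.lt_iff, ofLex_toLex]
  rfl

theorem wordLT_irrefl (u : FreeSemigroup X) : ¬ WordLT deg u u := by simp [wordLT_iff]

theorem wordLT_trans {u v w : FreeSemigroup X} (h : WordLT deg u v) (h' : WordLT deg v w) :
    WordLT deg u w := by
  rw [wordLT_iff] at *
  exact h.trans h'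

theorem wordLT_trichotomy (u v : FreeSemigroup X) :
    WordLT deg u v ∨ u = v ∨ WordLT deg v u := by
  simp only [wordLT_iff, ← (wordKey_injective (deg := deg)).eq_iff]
  exact lt_trichotomy _ _

/-- The order is contained in the lexicographic product of `<` on degrees and the shortlex order on
lists of letters, both well-founded. -/
theorem wordLT_wf [WellFoundedLT X] : WellFounded (WordLT (X := X) deg) := by
  have h := InvImage.wf (fun u : FreeSemigroup X => (wordDeg deg u, letters u))
    (WellFounded.prod_lex (Nat.lt_wfRel.wf) (List.Shortlex.wf (wellFounded_lt (α := X))))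
  refine Subrelation.wf ?_ h
  rintro u v (h | ⟨h, h'⟩)
  · exact Prod.Lex.left _ _ h
  · change Prod.Lex _ _ (_, _) (_, _)
    rw [h]
    exact Prod.Lex.right _ (List.shortlex_def.2 h')

theorem wordDeg_le_of_wordLT {u v : FreeSemigroup X} (h : WordLT deg u v) :
    wordDeg deg u ≤ wordDeg deg v := by
  rcases h with h | h
  · exact h.le
  · exact h.1.le

theorem wordLT_of_wordDeg_lt {u v : FreeSemigroup X} (h : wordDeg deg u < wordDeg deg v) :
    WordLT deg u v := Or.inl h

/-- With equal lengths the comparison is decided at a common position. A proper prefix is also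
lexicographically smaller, and there appending letters could reverse the comparison. -/
theorem lex_append_of_length_eq : ∀ {s t : List X} (l : List X), s.length = t.length →
    List.Lex (· < ·) s t → List.Lex (· < ·) (s ++ l) (t ++ l)
  | _, _, _, h, .nil => by simp at h
  | _, _, l, h, .cons h' => .cons (lex_append_of_length_eq l (by simpa using h) h')
  | _, _, _, _, .rel h' => .rel h'

theorem wordLT_wapp {u v : FreeSemigroup X} (l : List X) (h : WordLT deg u v) :
    WordLT deg (wapp u l) (wapp v l) := by
  simp only [WordLT, wordDeg_wapp, length_wapp, add_lt_add_iff_right, add_left_inj] at h ⊢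
  refine h.imp_right (And.imp_right (Or.imp_right ?_))
  rintro ⟨h1, h2⟩
  exact ⟨h1, lex_append_of_length_eq (s := letters u) (t := letters v) l h1 h2⟩

theorem wordLT_mul_left {v v' : FreeSemigroup X} (u : FreeSemigroup X) (h : WordLT deg v v') :
    WordLT deg (u * v) (u * v') := by
  simp only [WordLT, wordDeg_mul, FreeSemigroup.length_mul, add_lt_add_iff_left,
    add_right_inj] at h ⊢
  refine h.imp_right (And.imp_right (Or.imp_right ?_))
  rintro ⟨h1, h2⟩
  refine ⟨h1, ?_⟩
  have := List.Lex.append_left (· < ·) h2 (letters u)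
  simpa [letters] using this

/-- A word smaller than a letter is a letter or has smaller degree. -/
theorem wordLT_of_cases {v : FreeSemigroup X} {x : X} (h : WordLT deg v (FreeSemigroup.of x)) :
    wordDeg deg v < deg x ∨ ∃ y, v = FreeSemigroup.of y := by
  rcases h with h | ⟨_, h | ⟨h, _⟩⟩
  · exact Or.inl (by rwa [wordDeg_of] at h)
  · have := one_le_length v
    rw [length_of] at h
    omega
  · exact Or.inr (eq_of_of_length_eq_one h)

theorem not_wordLT_wapp (u : FreeSemigroup X) (l : List X) : ¬ WordLT deg (wapp u l) u := by
  intro h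
  simp only [WordLT, wordDeg_wapp, length_wapp] at h
  rcases h with h | ⟨_, h | ⟨h, h'⟩⟩
  · omega
  · omega
  · have : l = [] := List.length_eq_zero_iff.1 (by omega)
    subst this
    rw [wapp_nil] at h'
    exact lt_irrefl (letters u) h'

theorem wordLT_mul_of_self (hdeg : ∀ x, 0 < deg x) (u : FreeSemigroup X) (x : X) :
    WordLT deg (FreeSemigroup.of x) (u * FreeSemigroup.of x) := by
  left
  have := hdeg u.head
  rw [wordDeg_mul]
  simp only [wordDeg]
  omega

theorem exists_max_word {s : Finset (FreeSemigroup X)} (h : s.Nonempty) :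
    ∃ w ∈ s, ∀ v ∈ s, v ≠ w → WordLT deg v w := by
  obtain ⟨w, hw, h⟩ := s.exists_max_image (wordKey deg) h
  refine ⟨w, hw, fun v hv hne => wordLT_iff.2 ?_⟩
  exact lt_of_le_of_ne (h v hv) (fun h' => hne (wordKey_injective h'))

end Order

end Words

/-! ## Subspaces spanned by monomials -/

section Spans

variable {k X : Type*} [Field k] {p : X → ZMod 2}

variable (k p) in
/-- The span of the monomials `[u]_L` for the words `u` satisfying `P`. -/
def wspan (P : FreeSemigroup X → Prop) : Submodule k (Lbs k p) :=
  Submodule.span k (nf k p '' {u | P u})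

theorem nfBasis_apply (u : FreeSemigroup X) : nfBasis k p u = nf k p u := by
  simp [nfBasis]

theorem coe_nfBasis : ⇑(nfBasis k p) = nf k p := funext nfBasis_apply

theorem repr_nf (u : FreeSemigroup X) : (nfBasis k p).repr (nf k p u) = Finsupp.single u 1 := by
  rw [← nfBasis_apply, Module.Basis.repr_self]

theorem nf_mem_wspan {P : FreeSemigroup X → Prop} {u : FreeSemigroup X} (h : P u) :
    nf k p u ∈ wspan k p P := Submodule.subset_span ⟨u, h, rfl⟩

theorem mem_supp {f : Lbs k p} {u : FreeSemigroup X} :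
    u ∈ supp f ↔ (nfBasis k p).repr f u ≠ 0 := by
  simp [supp]

theorem mem_wspan {P : FreeSemigroup X → Prop} {f : Lbs k p} :
    f ∈ wspan k p P ↔ ∀ u ∈ supp f, P u := by
  rw [wspan, ← coe_nfBasis, Module.Basis.mem_span_image]
  rfl

theorem wspan_mono {P Q : FreeSemigroup X → Prop} (h : ∀ u, P u → Q u) :
    wspan k p P ≤ wspan k p Q :=
  Submodule.span_mono (Set.image_mono h)

theorem wspan_le {P : FreeSemigroup X → Prop} {N : Submodule k (Lbs k p)}
    (h : ∀ u, P u → nf k p u ∈ N) : wspan k p P ≤ N := by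
  rw [wspan, Submodule.span_le]
  rintro _ ⟨u, hu, rfl⟩
  exact h u hu

theorem map_mem_of_wspan {P : FreeSemigroup X → Prop} {N : Submodule k (Lbs k p)}
    (T : Lbs k p →ₗ[k] Lbs k p) (h : ∀ u, P u → T (nf k p u) ∈ N) {f : Lbs k p}
    (hf : f ∈ wspan k p P) : T f ∈ N :=
  wspan_le (N := N.comap T) h hf

theorem supp_eq_empty {f : Lbs k p} : supp f = ∅ ↔ f = 0 := by
  simp [supp]

theorem mul_mem_of_wspan_right {P : FreeSemigroup X → Prop} {N : Submodule k (Lbs k p)}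
    (g : Lbs k p) (h : ∀ u, P u → g * nf k p u ∈ N) {f : Lbs k p}
    (hf : f ∈ wspan k p P) : g * f ∈ N :=
  map_mem_of_wspan (LinearMap.mulLeft k g) h hf

theorem mul_mem_of_wspan_left {P : FreeSemigroup X → Prop} {N : Submodule k (Lbs k p)}
    (g : Lbs k p) (h : ∀ u, P u → nf k p u * g ∈ N) {f : Lbs k p}
    (hf : f ∈ wspan k p P) : f * g ∈ N :=
  map_mem_of_wspan (LinearMap.mulRight k g) h hf

theorem mem_wspan_true (f : Lbs k p) : f ∈ wspan k p (fun _ => True) :=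
  mem_wspan.2 fun _ _ => trivial

theorem repr_eq_zero_of_mem_wspan {P : FreeSemigroup X → Prop} {f : Lbs k p} {w : FreeSemigroup X}
    (hf : f ∈ wspan k p P) (hw : ¬ P w) : (nfBasis k p).repr f w = 0 := by
  by_contra h
  exact hw (mem_wspan.1 hf w (mem_supp.2 h))

end Spans

/-! ## Products and parity -/

section Products

variable {k X : Type*} [Field k] {p : X → ZMod 2}

theorem rmul_append (f : Lbs k p) (l m : List X) : rmul f (l ++ m) = rmul (rmul f l) m := by
  simp [rmul]

theorem rmul_nil (f : Lbs k p) : rmul f [] = f := rfl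

theorem rmul_singleton (f : Lbs k p) (a : X) : rmul f [a] = f * Lbs.ι k p a := rfl

theorem rmul_nf (u : FreeSemigroup X) (l : List X) : rmul (nf k p u) l = nf k p (wapp u l) := by
  simp [nf, rmul, wapp]

/-- Right multiplication by a list of letters, as a linear map. -/
def rmulLin (l : List X) : Lbs k p →ₗ[k] Lbs k p where
  toFun f := rmul f l
  map_add' f g := by
    induction l using List.reverseRecOn with
    | nil => rfl
    | append_singleton l a ih => simp only [rmul_append, rmul_singleton, ih, add_mul]
  map_smul' c f := by
    induction l using List.reverseRecOn with
    | nil => rfl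
    | append_singleton l a ih =>
      simp only [rmul_append, rmul_singleton, ih, smul_mul_assoc, RingHom.id_apply]

theorem rmul_sub (f g : Lbs k p) (l : List X) : rmul (f - g) l = rmul f l - rmul g l :=
  map_sub (rmulLin l) f g

theorem rmul_mem_of_wspan {P : FreeSemigroup X → Prop} {N : Submodule k (Lbs k p)} (l : List X)
    (h : ∀ u, P u → nf k p (wapp u l) ∈ N) {f : Lbs k p} (hf : f ∈ wspan k p P) :
    rmul f l ∈ N :=
  map_mem_of_wspan (rmulLin l) (fun u hu => by
    change rmul _ _ ∈ N
    rw [rmul_nf]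
    exact h u hu) hf

theorem nf_mul_ι (u : FreeSemigroup X) (a : X) :
    nf k p u * Lbs.ι k p a = nf k p (u * FreeSemigroup.of a) := (nf_mul_of k p u a).symm

/-- The Leibniz identity for homogeneous elements. -/
theorem mul_mul_of_part {i j : ZMod 2} {g h : Lbs k p} (hg : g ∈ Lbs.part k p i)
    (hh : h ∈ Lbs.part k p j) (f : Lbs k p) :
    f * (g * h) = (f * g) * h - sgn k i j • ((f * h) * g) := by
  induction hg using Submodule.span_induction with
  | zero => simp
  | add x y _ _ hx hy => simp only [mul_add, add_mul, hx, hy, smul_add]; abel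
  | smul c x _ hx =>
    simp only [mul_smul_comm, smul_mul_assoc, hx, smul_sub]
    rw [smul_comm c]
  | mem x hx =>
    obtain ⟨ν, rfl, rfl⟩ := hx
    induction hh using Submodule.span_induction with
    | zero => simp
    | add x y _ _ hx hy => simp only [mul_add, add_mul, hx, hy, smul_add]; abel
    | smul c x _ hx =>
      simp only [mul_smul_comm, smul_mul_assoc, hx, smul_sub]
      rw [smul_comm c]
    | mem x hx =>
      obtain ⟨τ, rfl, rfl⟩ := hx
      exact mul_mul_term k p f ν τ

theorem ι_mem_part (a : X) : Lbs.ι k p a ∈ Lbs.part k p (p a) :=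
  Submodule.subset_span ⟨FreeMagma.of a, rfl, rfl⟩

theorem mul_mem_part {i j : ZMod 2} {f g : Lbs k p} (hf : f ∈ Lbs.part k p i)
    (hg : g ∈ Lbs.part k p j) : f * g ∈ Lbs.part k p (i + j) := by
  induction hf using Submodule.span_induction with
  | zero => simp
  | add x y _ _ hx hy => rw [add_mul]; exact add_mem hx hy
  | smul c x _ hx => rw [smul_mul_assoc]; exact Submodule.smul_mem _ _ hx
  | mem x hx =>
    obtain ⟨ν, rfl, rfl⟩ := hx
    induction hg using Submodule.span_induction with
    | zero => simp
    | add x y _ _ hx hy => rw [mul_add]; exact add_mem hx hy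
    | smul c x _ hx => rw [mul_smul_comm]; exact Submodule.smul_mem _ _ hx
    | mem x hx =>
      obtain ⟨τ, rfl, rfl⟩ := hx
      exact Submodule.subset_span ⟨ν * τ, rfl, by rw [term_mul, Lbs.mk_mul]⟩

theorem nf_mem_part (u : FreeSemigroup X) : nf k p u ∈ Lbs.part k p (wordParity p u) := by
  induction u using word_induction with
  | h1 x => rw [wordParity_of]; exact ι_mem_part x
  | h2 u a ih => rw [nf_mul_of, wordParity_mul_of]; exact mul_mem_part ih (ι_mem_part a)

/-- The Leibniz identity unfolds right multiplication by a term into right multiplications by its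
letters, which send words to words and add parities. -/
theorem mul_term_mem_wspan (τ : FreeMagma X) : ∀ (i : ZMod 2) (f : Lbs k p),
    f ∈ wspan k p (fun u => wordParity p u = i) →
      f * Lbs.mk k p (term k τ) ∈ wspan k p (fun u => wordParity p u = i + termParity p τ) := by
  induction τ with
  | ih1 a =>
    intro i f hf
    refine mul_mem_of_wspan_left _ (fun u hu => ?_) hf
    change nf k p u * Lbs.ι k p a ∈ _
    rw [nf_mul_ι]
    exact nf_mem_wspan (by rw [wordParity_mul_of, hu]; rfl)
  | ih2 ν τ hν hτ =>
    intro i f hf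
    rw [term_mul, Lbs.mk_mul, mul_mul_term]
    have h1 := hτ _ _ (hν _ f hf)
    have h2 := hν _ _ (hτ _ f hf)
    rw [add_assoc] at h1
    rw [add_assoc, add_comm (termParity p τ)] at h2
    exact sub_mem h1 (Submodule.smul_mem _ _ h2)

/-- This lets parity, defined through bracketed terms, be read off from the basis of words. -/
theorem part_eq_wspan (i : ZMod 2) :
    Lbs.part k p i = wspan k p (fun u => wordParity p u = i) := by
  apply le_antisymm
  · refine Submodule.span_le.2 ?_
    rintro _ ⟨μ, rfl, rfl⟩
    induction μ with
    | ih1 x => exact nf_mem_wspan (u := FreeSemigroup.of x) (wordParity_of p x)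
    | ih2 μ ν hμ _ =>
      rw [term_mul, Lbs.mk_mul]
      exact mul_term_mem_wspan ν _ _ hμ
  · refine wspan_le ?_
    rintro u rfl
    exact nf_mem_part u

theorem isHomogeneous_iff {f : Lbs k p} : IsHomogeneous f ↔ ∃ i, f ∈ Lbs.part k p i := by
  simp only [part_eq_wspan, mem_wspan]
  constructor
  · rintro (h | h)
    · exact ⟨0, h⟩
    · exact ⟨1, h⟩
  · rintro ⟨i, h⟩
    have hz : ∀ t : ZMod 2, t = 0 ∨ t = 1 := by decide
    rcases hz i with rfl | rfl
    · exact Or.inl h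
    · exact Or.inr h

theorem rmul_mem_part {i : ZMod 2} {f : Lbs k p} (hf : f ∈ Lbs.part k p i) (l : List X) :
    ∃ j, rmul f l ∈ Lbs.part k p j := by
  induction l using List.reverseRecOn with
  | nil => exact ⟨i, hf⟩
  | append_singleton l a ih =>
    obtain ⟨j, hj⟩ := ih
    exact ⟨j + p a, by rw [rmul_append]; exact mul_mem_part hj (ι_mem_part a)⟩

/-- The product of two monomials is a combination of monomials of the same total degree. -/
theorem nf_mul_nf_mem (deg : X → ℕ) (v : FreeSemigroup X) : ∀ u : FreeSemigroup X,
    nf k p u * nf k p v ∈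
      wspan k p (fun w => wordDeg deg w = wordDeg deg u + wordDeg deg v) := by
  induction v using word_induction with
  | h1 x =>
    intro u
    rw [nf_of, nf_mul_ι]
    exact nf_mem_wspan (wordDeg_mul deg _ _)
  | h2 v a ih =>
    intro u
    -- `u(va) = (uv)a ∓ (ua)v`; the second summand is why the induction on `v` must keep `u`
    -- arbitrary.
    rw [nf_mul_of, mul_mul_of_part (nf_mem_part v) (ι_mem_part a)]
    refine sub_mem ?_ (Submodule.smul_mem _ _ ?_)
    · refine mul_mem_of_wspan_left _ (fun w hw => ?_) (ih u)
      rw [nf_mul_ι]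
      exact nf_mem_wspan (by rw [wordDeg_mul, wordDeg_mul, hw, add_assoc])
    · rw [nf_mul_ι]
      have := ih (u * FreeSemigroup.of a)
      refine wspan_mono (fun w hw => ?_) this
      rw [hw, wordDeg_mul, wordDeg_mul]
      omega

/-! ### Homogeneous components -/

variable (k p) in
/-- The projection of `Lbs(X)` onto its part of parity `i`. -/
def partProj (i : ZMod 2) : Lbs k p →ₗ[k] Lbs k p :=
  (nfBasis k p).constr k fun u => if wordParity p u = i then nf k p u else 0

theorem partProj_nf (i : ZMod 2) (u : FreeSemigroup X) :
    partProj k p i (nf k p u) = if wordParity p u = i then nf k p u else 0 := by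
  rw [partProj, ← nfBasis_apply, Module.Basis.constr_basis, nfBasis_apply]

theorem partProj_mem_part (i : ZMod 2) (f : Lbs k p) : partProj k p i f ∈ Lbs.part k p i := by
  refine map_mem_of_wspan _ (fun u _ => ?_) (mem_wspan_true f)
  rw [partProj_nf]
  split_ifs with h
  · exact h ▸ nf_mem_part u
  · exact zero_mem _

theorem partProj_of_mem {i : ZMod 2} {f : Lbs k p} (hf : f ∈ Lbs.part k p i) :
    partProj k p i f = f := by
  rw [part_eq_wspan] at hf
  -- Landing in `⊥` means vanishing: the projection minus the identity is checked on the monomials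
  -- of parity `i`.
  have := map_mem_of_wspan (N := (⊥ : Submodule k (Lbs k p)))
    (partProj k p i - LinearMap.id) (fun u hu => by simp [partProj_nf, hu]) hf
  simpa [sub_eq_zero] using this

theorem partProj_of_mem_ne {i j : ZMod 2} (hij : j ≠ i) {f : Lbs k p}
    (hf : f ∈ Lbs.part k p j) : partProj k p i f = 0 := by
  rw [part_eq_wspan] at hf
  have := map_mem_of_wspan (N := (⊥ : Submodule k (Lbs k p)))
    (partProj k p i) (fun u hu => by simp [partProj_nf, hu, hij]) hf
  simpa using this

variable {I : Submodule k (Lbs k p)}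

/-- This is the form in which gradedness of an ideal is used. -/
theorem partProj_mem_ideal (hI : IsGradedIdeal I) (i : ZMod 2) {f : Lbs k p} (hf : f ∈ I) :
    partProj k p i f ∈ I := by
  rw [hI.2] at hf
  obtain ⟨g, hg, h, hh, rfl⟩ := Submodule.mem_sup.1 hf
  have hz : ∀ t : ZMod 2, t = 0 ∨ t = 1 := by decide
  rw [map_add]
  rcases hz i with rfl | rfl
  · rw [partProj_of_mem hg.2, partProj_of_mem_ne (by decide) hh.2, add_zero]
    exact hg.1
  · rw [partProj_of_mem hh.2, partProj_of_mem_ne (by decide) hg.2, zero_add]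
    exact hh.1

/-- If all letters are even then every ideal is graded. -/
theorem IsIdeal.isGradedIdeal (hp : ∀ x, p x = 0) (hI : IsIdeal I) : IsGradedIdeal I := by
  have h0 : ∀ u : FreeSemigroup X, wordParity p u = 0 := by
    intro u
    induction u using word_induction with
    | h1 x => rw [wordParity_of, hp]
    | h2 u a ih => rw [wordParity_mul_of, ih, hp, add_zero]
  have htop : Lbs.part k p 0 = ⊤ := by
    rw [part_eq_wspan, eq_top_iff]
    exact fun f _ => mem_wspan.2 fun u _ => h0 u
  refine ⟨hI, ?_⟩
  rw [htop, inf_top_eq]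
  exact (sup_eq_left.2 inf_le_left).symm

end Products

/-! ## Leading monomials -/

section Leading

variable {k X : Type*} [Field k] [LinearOrder X] {p : X → ZMod 2} {deg : X → ℕ}

variable (deg) in
/-- `f` is monic with leading monomial `[w]_L`. -/
def HasMonicLead (f : Lbs k p) (w : FreeSemigroup X) : Prop :=
  f - nf k p w ∈ wspan k p (fun v => WordLT deg v w)

theorem HasMonicLead.repr_eq_one {f : Lbs k p} {w : FreeSemigroup X}
    (h : HasMonicLead deg f w) : (nfBasis k p).repr f w = 1 := by
  have := repr_eq_zero_of_mem_wspan h (wordLT_irrefl w)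
  rw [map_sub, repr_nf, Finsupp.sub_apply, Finsupp.single_eq_same, sub_eq_zero] at this
  exact this

theorem HasMonicLead.isLeading {f : Lbs k p} {w : FreeSemigroup X}
    (h : HasMonicLead deg f w) : IsLeading deg f w := by
  refine ⟨mem_supp.2 (by simp [h.repr_eq_one]), fun v hv hne => mem_wspan.1 h v ?_⟩
  rw [mem_supp] at hv ⊢
  rwa [map_sub, repr_nf, Finsupp.sub_apply, Finsupp.single_eq_of_ne hne, sub_zero]

theorem HasMonicLead.isMonic {f : Lbs k p} {w : FreeSemigroup X}
    (h : HasMonicLead deg f w) : IsMonic deg f := ⟨w, h.isLeading, h.repr_eq_one⟩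

theorem IsLeading.unique {f : Lbs k p} {v w : FreeSemigroup X} (hv : IsLeading deg f v)
    (hw : IsLeading deg f w) : v = w := by
  by_contra h
  exact wordLT_irrefl v (wordLT_trans (hw.2 v hv.1 h) (hv.2 w hw.1 (Ne.symm h)))

theorem IsLeading.ne_zero {f : Lbs k p} {w : FreeSemigroup X} (h : IsLeading deg f w) :
    f ≠ 0 := by
  rintro rfl
  simpa [supp] using h.1

theorem exists_isLeading {f : Lbs k p} (h : f ≠ 0) : ∃ w, IsLeading deg f w :=
  exists_max_word (Finset.nonempty_iff_ne_empty.2 (mt supp_eq_empty.1 h))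

theorem IsLeading.hasMonicLead {f : Lbs k p} {w : FreeSemigroup X} (h : IsLeading deg f w) :
    HasMonicLead deg (((nfBasis k p).repr f w)⁻¹ • f) w := by
  refine mem_wspan.2 fun v hv => ?_
  rw [mem_supp, map_sub, repr_nf, map_smul, Finsupp.sub_apply, Finsupp.smul_apply,
    smul_eq_mul] at hv
  by_cases hvw : v = w
  · subst hvw
    simp [inv_mul_cancel₀ (mem_supp.1 h.1)] at hv
  · refine h.2 v (mem_supp.2 fun h0 => ?_) hvw
    simp [h0, hvw] at hv

theorem IsMonic.hasMonicLead {f : Lbs k p} (hf : IsMonic deg f) {w : FreeSemigroup X}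
    (h : IsLeading deg f w) : HasMonicLead deg f w := by
  obtain ⟨w', h', h1⟩ := hf
  obtain rfl := h'.unique h
  simpa [h1] using h'.hasMonicLead

/-- Right multiplication by letters sends monomials to monomials and preserves their order. -/
theorem HasMonicLead.rmul {f : Lbs k p} {w : FreeSemigroup X} (h : HasMonicLead deg f w)
    (l : List X) : HasMonicLead deg (rmul f l) (wapp w l) := by
  rw [HasMonicLead, ← rmul_nf, ← rmul_sub]
  refine rmul_mem_of_wspan l (fun u hu => ?_) h
  apply nf_mem_wspan
  exact wordLT_wapp l hu

/-- For general products with `u` on the left only the degree is under control. Below a letter `x`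
this is enough: a smaller word has smaller degree, or is a letter `y`, and then the product is the
monomial of `u y`, which is smaller than `u x`. -/
theorem HasMonicLead.nf_mul {f : Lbs k p} {x : X} (h : HasMonicLead deg f (FreeSemigroup.of x))
    (u : FreeSemigroup X) : HasMonicLead deg (nf k p u * f) (u * FreeSemigroup.of x) := by
  rw [HasMonicLead, ← nf_mul_ι, ← nf_of, ← mul_sub]
  refine mul_mem_of_wspan_right _ (fun v hv => ?_) h
  rcases wordLT_of_cases hv with h1 | ⟨y, rfl⟩
  · refine wspan_mono (fun w hw => wordLT_of_wordDeg_lt ?_) (nf_mul_nf_mem deg v u)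
    rw [hw, wordDeg_mul, wordDeg_of]
    omega
  · rw [nf_of, nf_mul_ι]
    exact nf_mem_wspan (wordLT_mul_left u hv)

/-- If `f` and `g` are monic with the same leading monomial `[w]_L` then the monomials of `f - g`
are smaller. -/
theorem HasMonicLead.sub_mem {f g : Lbs k p} {w : FreeSemigroup X} (hf : HasMonicLead deg f w)
    (hg : HasMonicLead deg g w) : f - g ∈ wspan k p (fun v => WordLT deg v w) := by
  have := Submodule.sub_mem _ hf hg
  rwa [sub_sub_sub_cancel_right] at this

end Leading

/-! ## Normal polynomials -/

section Normal

variable {k X : Type*} [Field k] [LinearOrder X] {p : X → ZMod 2} {deg : X → ℕ}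

variable (deg) in
/-- `c`, with leading monomial `[q]_L`, is `s` or, if the leading monomial of `s` is a letter, the
product of a monomial and `s`. -/
def IsCore (s c : Lbs k p) (q : FreeSemigroup X) : Prop :=
  (c = s ∧ HasMonicLead deg s q) ∨
    ∃ x u, HasMonicLead deg s (FreeSemigroup.of x) ∧ c = nf k p u * s ∧ q = u * FreeSemigroup.of x

theorem IsCore.hasMonicLead {s c : Lbs k p} {q : FreeSemigroup X} (h : IsCore deg s c q) :
    HasMonicLead deg c q := by
  rcases h with ⟨rfl, h⟩ | ⟨x, u, h, rfl, rfl⟩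
  · exact h
  · exact h.nf_mul u

theorem IsCore.isNormalOf {s c : Lbs k p} {q : FreeSemigroup X} (h : IsCore deg s c q)
    (l : List X) : IsNormalOf deg s (rmul c l) := by
  rcases h with ⟨rfl, _⟩ | ⟨x, u, h, rfl, rfl⟩
  · exact Or.inl ⟨l, rfl⟩
  · exact Or.inr ⟨⟨_, h.isLeading, rfl⟩, u, l, rfl⟩

theorem IsNormalOf.exists_isCore {s h : Lbs k p} (hs : IsMonic deg s)
    (hh : IsNormalOf deg s h) : ∃ c q l, IsCore deg s c q ∧ h = rmul c l := by
  rcases hh with ⟨l, rfl⟩ | ⟨⟨w, hw, h1⟩, u, l, rfl⟩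
  · obtain ⟨w, hw, _⟩ := id hs
    exact ⟨s, w, l, Or.inl ⟨rfl, hs.hasMonicLead hw⟩, rfl⟩
  · obtain ⟨x, rfl⟩ := eq_of_of_length_eq_one h1
    exact ⟨_, _, l, Or.inr ⟨x, u, hs.hasMonicLead hw, rfl, rfl⟩, rfl⟩

theorem IsNormalOf.isMonic {s h : Lbs k p} (hs : IsMonic deg s) (hh : IsNormalOf deg s h) :
    IsMonic deg h := by
  obtain ⟨c, q, l, hc, rfl⟩ := hh.exists_isCore hs
  exact (hc.hasMonicLead.rmul l).isMonic

theorem IsNormalOf.rmul {s h : Lbs k p} (hh : IsNormalOf deg s h) (m : List X) :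
    IsNormalOf deg s (rmul h m) := by
  rcases hh with ⟨l, rfl⟩ | ⟨h1, u, l, rfl⟩
  · exact Or.inl ⟨l ++ m, by rw [rmul_append]⟩
  · exact Or.inr ⟨h1, u, l ++ m, by rw [rmul_append]⟩

theorem IsNormalOf.exists_mem_part {s h : Lbs k p} (hs : IsHomogeneous s)
    (hh : IsNormalOf deg s h) : ∃ i, h ∈ Lbs.part k p i := by
  obtain ⟨i, hi⟩ := isHomogeneous_iff.1 hs
  rcases hh with ⟨l, rfl⟩ | ⟨-, u, l, rfl⟩
  · exact rmul_mem_part hi l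
  · exact rmul_mem_part (mul_mem_part (nf_mem_part u) hi) l

theorem IsNormalOf.mem_ideal {I : Submodule k (Lbs k p)} (hI : IsIdeal I) {s h : Lbs k p}
    (hs : s ∈ I) (hh : IsNormalOf deg s h) : h ∈ I := by
  have key : ∀ (l : List X) (f : Lbs k p), f ∈ I → LeibnizGS.rmul f l ∈ I := by
    intro l f hf
    induction l using List.reverseRecOn with
    | nil => exact hf
    | append_singleton l a ih => rw [rmul_append]; exact (hI _ _ ih).2
  rcases hh with ⟨l, rfl⟩ | ⟨-, u, l, rfl⟩
  · exact key l s hs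
  · exact key l _ (hI _ _ hs).1

variable (deg) in
/-- The span of the normal `S`-polynomials whose leading words satisfy `P`. -/
def normalSpan (S : Set (Lbs k p)) (P : FreeSemigroup X → Prop) : Submodule k (Lbs k p) :=
  Submodule.span k {h | IsNormal deg S h ∧ ∃ v, IsLeading deg h v ∧ P v}

variable {S : Set (Lbs k p)}

theorem normalSpan_mono {P Q : FreeSemigroup X → Prop} (h : ∀ u, P u → Q u) :
    normalSpan deg S P ≤ normalSpan deg S Q :=
  Submodule.span_mono fun _ ⟨hn, v, hv, hP⟩ => ⟨hn, v, hv, h v hP⟩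

theorem IsNormalOf.mem_normalSpan {P : FreeSemigroup X → Prop} {s h : Lbs k p} (hs : s ∈ S)
    (hh : IsNormalOf deg s h) {w : FreeSemigroup X} (hw : HasMonicLead deg h w) (hP : P w) :
    h ∈ normalSpan deg S P :=
  Submodule.subset_span ⟨⟨s, hs, hh⟩, w, hw.isLeading, hP⟩

/-- Reduces a membership to the spanning normal polynomials, which are monic because the elements of
`S` are. -/
theorem map_mem_of_normalSpan (hm : ∀ s ∈ S, IsMonic deg s) {P : FreeSemigroup X → Prop}
    {N : Submodule k (Lbs k p)} (T : Lbs k p →ₗ[k] Lbs k p)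
    (h : ∀ s ∈ S, ∀ g, IsNormalOf deg s g → ∀ v, HasMonicLead deg g v → P v → T g ∈ N)
    {f : Lbs k p} (hf : f ∈ normalSpan deg S P) : T f ∈ N := by
  suffices normalSpan deg S P ≤ N.comap T from this hf
  refine Submodule.span_le.2 ?_
  rintro g ⟨⟨s, hs, hg⟩, v, hv, hP⟩
  exact h s hs g hg v ((hg.isMonic (hm s hs)).hasMonicLead hv) hP

theorem rmul_mem_normalSpan (hm : ∀ s ∈ S, IsMonic deg s) {P Q : FreeSemigroup X → Prop}
    (l : List X) (h : ∀ v, P v → Q (wapp v l)) {f : Lbs k p} (hf : f ∈ normalSpan deg S P) :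
    rmul f l ∈ normalSpan deg S Q :=
  map_mem_of_normalSpan hm (rmulLin l)
    (fun _ hs _ hg v hv hP => (hg.rmul l).mem_normalSpan hs (hv.rmul l) (h v hP)) hf

theorem mul_ι_mem_normalSpan (hm : ∀ s ∈ S, IsMonic deg s) {n : ℕ} (a : X) {f : Lbs k p}
    (hf : f ∈ normalSpan deg S (fun v => wordDeg deg v ≤ n)) :
    f * Lbs.ι k p a ∈ normalSpan deg S (fun v => wordDeg deg v ≤ n + deg a) :=
  rmul_mem_normalSpan hm [a] (fun v hv => by simpa [wordDeg_wapp] using hv) hf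

/-- Right multiplication by a monomial. -/
theorem mul_nf_mem_normalSpan (hm : ∀ s ∈ S, IsMonic deg s) (v : FreeSemigroup X) :
    ∀ (n : ℕ) (f : Lbs k p), f ∈ normalSpan deg S (fun v => wordDeg deg v ≤ n) →
      f * nf k p v ∈ normalSpan deg S (fun w => wordDeg deg w ≤ n + wordDeg deg v) := by
  induction v using word_induction with
  | h1 x =>
    intro n f hf
    rw [nf_of, wordDeg_of]
    exact mul_ι_mem_normalSpan hm x hf
  | h2 v a ih =>
    intro n f hf
    rw [nf_mul_of, mul_mul_of_part (nf_mem_part v) (ι_mem_part a)]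
    have h1 := mul_ι_mem_normalSpan hm a (ih n f hf)
    have h2 := ih _ _ (mul_ι_mem_normalSpan hm a hf)
    rw [wordDeg_mul, wordDeg_of]
    rw [add_assoc] at h1
    rw [add_assoc, add_comm (deg a)] at h2
    exact sub_mem h1 (Submodule.smul_mem _ _ h2)

/-- If `nf u * h` is controlled for all `u` then so is `nf u * [h a₁ ⋯ aₘ]_L`. -/
theorem nf_mul_rmul_mem_normalSpan (hm : ∀ s ∈ S, IsMonic deg s) {i : ZMod 2} {h : Lbs k p}
    (hi : h ∈ Lbs.part k p i) {n : ℕ} (H : ∀ u, nf k p u * h ∈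
      normalSpan deg S (fun w => wordDeg deg w ≤ wordDeg deg u + n)) (l : List X) :
    ∀ u, nf k p u * rmul h l ∈
      normalSpan deg S (fun w => wordDeg deg w ≤ wordDeg deg u + (n + (l.map deg).sum)) := by
  induction l using List.reverseRecOn with
  | nil => simpa [rmul_nil] using H
  | append_singleton l a ih =>
    intro u
    obtain ⟨j, hj⟩ := rmul_mem_part hi l
    -- For `g = [h a₁ ⋯]_L`, `u(ga) = (ug)a ∓ (ua)g`, and the induction hypothesis covers both `u`
    -- and `ua`.
    rw [rmul_append, rmul_singleton, mul_mul_of_part hj (ι_mem_part a)]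
    refine sub_mem ?_ (Submodule.smul_mem _ _ ?_)
    · refine normalSpan_mono (fun w hw => ?_) (mul_ι_mem_normalSpan hm a (ih u))
      simp only [List.map_append, List.sum_append, List.map_singleton, List.sum_singleton]
      omega
    · rw [nf_mul_ι]
      refine normalSpan_mono (fun w hw => ?_) (ih (u * FreeSemigroup.of a))
      rw [wordDeg_mul, wordDeg_of] at hw
      simp only [List.map_append, List.sum_append, List.map_singleton, List.sum_singleton]
      omega

/-- Left multiplication of a core by a monomial. -/
theorem nf_mul_core_mem_normalSpan (hS : IsGSBasis deg S) {s c : Lbs k p} {q : FreeSemigroup X}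
    (hs : s ∈ S) (hc : IsCore deg s c q) (u : FreeSemigroup X) :
    nf k p u * c ∈ normalSpan deg S (fun w => wordDeg deg w ≤ wordDeg deg u + wordDeg deg q) := by
  -- If the leading word of `s` is a letter, then `u s` is itself a normal polynomial, so no
  -- composition is needed.
  have letter : ∀ (x : X) (u : FreeSemigroup X), HasMonicLead deg s (FreeSemigroup.of x) →
      nf k p u * s ∈ normalSpan deg S (fun w => wordDeg deg w ≤ wordDeg deg u + deg x) := by
    intro x u hx
    have hcore : IsCore deg s (nf k p u * s) (u * FreeSemigroup.of x) :=
      Or.inr ⟨x, u, hx, rfl, rfl⟩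
    refine (hcore.isNormalOf []).mem_normalSpan hs hcore.hasMonicLead ?_
    rw [wordDeg_mul, wordDeg_of]
  rcases hc with ⟨rfl, hq⟩ | ⟨x, v, hx, rfl, rfl⟩
  · by_cases h1 : 1 < q.length
    · by_cases h0 : nf k p u * c = 0
      · rw [h0]; exact zero_mem _
      -- `TrivialModDeg` unfolds to the `normalSpan` with this degree bound.
      · exact hS.leftMul c hs q hq.isLeading h1 u h0
    · obtain ⟨x, rfl⟩ := eq_of_of_length_eq_one (le_antisymm (not_lt.1 h1) (one_le_length q))
      rw [wordDeg_of]
      exact letter x u hq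
  · obtain ⟨i, hi⟩ := isHomogeneous_iff.1 (hS.homogeneous s hs)
    -- `u(vs) = (uv)s ∓ (us)v`: expand `uv` into monomials in the first summand; the second is a
    -- normal polynomial multiplied on the right.
    rw [mul_mul_of_part (nf_mem_part v) hi]
    refine sub_mem ?_ (Submodule.smul_mem _ _ ?_)
    · refine mul_mem_of_wspan_left _ (fun w hw => ?_) (nf_mul_nf_mem deg v u)
      refine normalSpan_mono (fun w' hw' => ?_) (letter x w hx)
      rw [wordDeg_mul, wordDeg_of, ← add_assoc, ← hw]
      exact hw'
    · refine normalSpan_mono (fun w hw => ?_)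
        (mul_nf_mem_normalSpan hS.monic v _ _ (letter x u hx))
      rw [wordDeg_mul, wordDeg_of]
      omega

/-- Left multiplication of a normal polynomial by a monomial. -/
theorem nf_mul_mem_normalSpan (hS : IsGSBasis deg S) {s h : Lbs k p} {v : FreeSemigroup X}
    (hs : s ∈ S) (hh : IsNormalOf deg s h) (hv : HasMonicLead deg h v) (u : FreeSemigroup X) :
    nf k p u * h ∈ normalSpan deg S (fun w => wordDeg deg w ≤ wordDeg deg u + wordDeg deg v) := by
  obtain ⟨c, q, l, hc, rfl⟩ := hh.exists_isCore (hS.monic s hs)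
  obtain rfl := hv.isLeading.unique (hc.hasMonicLead.rmul l).isLeading
  obtain ⟨i, hi⟩ := (hc.isNormalOf []).exists_mem_part (hS.homogeneous s hs)
  rw [wordDeg_wapp]
  exact nf_mul_rmul_mem_normalSpan hS.monic hi (nf_mul_core_mem_normalSpan hS hs hc) l u

theorem isIdeal_normalSpan (hS : IsGSBasis deg S) :
    IsIdeal (normalSpan deg S (fun _ => True)) := by
  intro f g hg
  constructor
  · refine mul_mem_of_wspan_left g (fun u _ => ?_) (mem_wspan_true f)
    refine map_mem_of_normalSpan hS.monic (LinearMap.mulLeft k (nf k p u)) ?_ hg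
    intro s hs h hh v hv _
    exact normalSpan_mono (fun _ _ => trivial) (nf_mul_mem_normalSpan hS hs hh hv u)
  · refine mul_mem_of_wspan_right g (fun u _ => ?_) (mem_wspan_true f)
    refine map_mem_of_normalSpan hS.monic (LinearMap.mulRight k (nf k p u)) ?_ hg
    intro s hs h hh v hv _
    exact normalSpan_mono (fun _ _ => trivial)
      (mul_nf_mem_normalSpan hS.monic u (wordDeg deg v) h (hh.mem_normalSpan hs hv le_rfl))

theorem idealSpan_eq_normalSpan (hS : IsGSBasis deg S) :
    idealSpan k S = normalSpan deg S (fun _ => True) := by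
  apply le_antisymm
  · refine idealSpan_le (isIdeal_normalSpan hS) fun s hs => ?_
    obtain ⟨w, hw, _⟩ := id (hS.monic s hs)
    exact Submodule.subset_span ⟨⟨s, hs, Or.inl ⟨[], rfl⟩⟩, w, hw, trivial⟩
  · refine Submodule.span_le.2 ?_
    rintro h ⟨⟨s, hs, hh⟩, -⟩
    exact hh.mem_ideal (isIdeal_idealSpan S) (subset_idealSpan S hs)

/-! ### Normal polynomials with equal leading words -/

/-- Two cores, one of whose leading words is a prefix of the other. -/
theorem rmul_core_sub_core_mem (hS : IsGSBasis deg S) {s s' c c' : Lbs k p}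
    {q : FreeSemigroup X} {m : List X} (hs : s ∈ S) (hs' : s' ∈ S) (hc : IsCore deg s c q)
    (hc' : IsCore deg s' c' (wapp q m)) :
    rmul c m - c' ∈ normalSpan deg S (fun v => WordLT deg v (wapp q m)) := by
  have hcm := hc.hasMonicLead.rmul m
  rcases hc' with ⟨rfl, hq'⟩ | ⟨x', u', hx', rfl, hqm⟩
  · by_cases hne : c' = s
    · subst hne
      -- The two cores come from the same element: either they coincide and `m` is empty, or its
      -- leading word would be both a letter and of length at least `2`.
      rcases hc with ⟨rfl, hq⟩ | ⟨x, u, hx, rfl, rfl⟩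
      · have h := hq.isLeading.unique hq'.isLeading
        obtain rfl : [] = m := wapp_right_injective q (by rw [wapp_nil]; exact h)
        rw [rmul_nil, sub_self]
        exact zero_mem _
      · have h := congrArg FreeSemigroup.length (hx.isLeading.unique hq'.isLeading)
        rw [length_wapp, FreeSemigroup.length_mul, length_of] at h
        have := one_le_length u
        omega
    -- Up to sign this is an inclusion composition of `c'` with a normal polynomial built from `s`.
    · rw [← neg_sub]
      exact neg_mem (hS.inclusion c' hs' s hs hne _ _ (hc.isNormalOf m) hq'.isLeading
        hcm.isLeading)
  · rcases List.eq_nil_or_concat' m with rfl | ⟨m, a, rfl⟩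
    · rw [wapp_nil] at hqm ⊢
      rw [rmul_nil]
      subst hqm
      have hc'core : IsCore deg s' (nf k p u' * s') (u' * FreeSemigroup.of x') :=
        Or.inr ⟨x', u', hx', rfl, rfl⟩
      rcases hc with ⟨rfl, hq⟩ | ⟨x, u, hx, rfl, hq⟩
      · refine hS.inclusion c hs s' hs' ?_ _ _ (hc'core.isNormalOf []) hq.isLeading
          hc'core.hasMonicLead.isLeading
        rintro rfl
        have h := congrArg FreeSemigroup.length (hx'.isLeading.unique hq.isLeading)
        rw [FreeSemigroup.length_mul, length_of] at h
        have := one_le_length u'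
        omega
      · obtain ⟨rfl, rfl⟩ := mul_of_inj hq
        -- Both cores carry the same prefix, so their difference is `u'` times the inclusion
        -- composition of `s` and `s'`. The latter involves only normal polynomials below the letter
        -- `x`.
        rw [← mul_sub]
        by_cases hne : s = s'
        · rw [hne, sub_self, mul_zero]; exact zero_mem _
        · have h := hS.inclusion s hs s' hs' hne s' _ (Or.inl ⟨[], rfl⟩) hx.isLeading
            hx'.isLeading
          refine map_mem_of_normalSpan hS.monic (LinearMap.mulLeft k (nf k p u')) ?_ h
          intro t ht g hg v hv hlt
          rcases wordLT_of_cases hlt with h1 | ⟨y, rfl⟩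
          · refine normalSpan_mono (fun w hw => wordLT_of_wordDeg_lt ?_)
              (nf_mul_mem_normalSpan hS ht hg hv u')
            rw [wordDeg_mul, wordDeg_of]
            omega
          -- A normal polynomial whose leading word is a letter is its own generator, so multiplying
          -- it by `u'` gives a normal polynomial again.
          · obtain ⟨c, q, l, hc, rfl⟩ := hg.exists_isCore (hS.monic t ht)
            have h2 := hv.isLeading.unique (hc.hasMonicLead.rmul l).isLeading
            have h3 := congrArg FreeSemigroup.length h2
            rw [length_wapp, length_of] at h3
            have hq1 := one_le_length q
            obtain rfl : l = [] := List.length_eq_zero_iff.1 (by omega)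
            rw [rmul_nil] at hv ⊢
            rw [wapp_nil] at h2
            subst h2
            rcases hc with ⟨rfl, hcq⟩ | ⟨z, w, hz, rfl, hzw⟩
            · have hcore : IsCore deg c (nf k p u' * c) (u' * FreeSemigroup.of y) :=
                Or.inr ⟨y, u', hcq, rfl, rfl⟩
              exact (hcore.isNormalOf []).mem_normalSpan ht hcore.hasMonicLead
                (wordLT_mul_left u' hlt)
            · have h := congrArg FreeSemigroup.length hzw
              rw [FreeSemigroup.length_mul, length_of, length_of] at h
              have := one_le_length w
              omega
    · rw [← wapp_wapp, wapp_singleton] at hqm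
      obtain ⟨rfl, rfl⟩ := mul_of_inj hqm
      rw [← wapp_wapp, wapp_singleton, rmul_append, rmul_singleton]
      have hg := hc.hasMonicLead.rmul m
      have hgn := hc.isNormalOf m
      generalize wapp q m = w at *
      generalize LeibnizGS.rmul c m = g at *
      -- The leading parts cancel without any composition: `ga - ws' = (g - w)s' - g(s' - a)`. Both
      -- summands expand, through the lower monomials of `g` and of `s'`, into normal polynomials
      -- with leading words below `wa`.
      have e : g * Lbs.ι k p a - nf k p w * s' =
          (g - nf k p w) * s' - g * (s' - nf k p (FreeSemigroup.of a)) := by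
        rw [sub_mul, mul_sub, nf_of]; abel
      rw [e]
      refine sub_mem ?_ ?_
      · refine mul_mem_of_wspan_left s' (fun v hv => ?_) hg
        have hcore : IsCore deg s' (nf k p v * s') (v * FreeSemigroup.of a) :=
          Or.inr ⟨a, v, hx', rfl, rfl⟩
        refine (hcore.isNormalOf []).mem_normalSpan hs' hcore.hasMonicLead ?_
        rw [← wapp_singleton, ← wapp_singleton]
        exact wordLT_wapp [a] hv
      · refine mul_mem_of_wspan_right g (fun v hv => ?_) hx'
        rcases wordLT_of_cases hv with h1 | ⟨y, rfl⟩
        · refine normalSpan_mono (fun w' hw' => wordLT_of_wordDeg_lt ?_)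
            (mul_nf_mem_normalSpan hS.monic v (wordDeg deg w) g
              (hgn.mem_normalSpan hs hg le_rfl))
          rw [wordDeg_mul, wordDeg_of]
          omega
        · refine (hgn.rmul [y]).mem_normalSpan hs (hg.rmul [y]) ?_
          rw [wapp_singleton]
          exact wordLT_mul_left w hv

/-- Two normal polynomials with the same leading monomial. -/
theorem normal_sub_normal_mem (hS : IsGSBasis deg S) {s s' h h' : Lbs k p}
    {w : FreeSemigroup X} (hs : s ∈ S) (hs' : s' ∈ S) (hh : IsNormalOf deg s h)
    (hh' : IsNormalOf deg s' h') (hw : IsLeading deg h w) (hw' : IsLeading deg h' w) :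
    h - h' ∈ normalSpan deg S (fun v => WordLT deg v w) := by
  obtain ⟨c, q, l, hc, rfl⟩ := hh.exists_isCore (hS.monic s hs)
  obtain ⟨c', q', l', hc', rfl⟩ := hh'.exists_isCore (hS.monic s' hs')
  have e := hw.unique (hc.hasMonicLead.rmul l).isLeading
  have e' := hw'.unique (hc'.hasMonicLead.rmul l').isLeading
  have key : ∀ {s s' c c' : Lbs k p} {q : FreeSemigroup X} {n l' : List X}, s ∈ S → s' ∈ S →
      IsCore deg s c q → IsCore deg s' c' (wapp q n) → w = wapp (wapp q n) l' →
      rmul c (n ++ l') - rmul c' l' ∈ normalSpan deg S (fun v => WordLT deg v w) := by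
    intro s s' c c' q n l' hs hs' hc hc' e
    rw [rmul_append, ← rmul_sub, e]
    refine rmul_mem_normalSpan hS.monic l' (fun v hv => ?_)
      (rmul_core_sub_core_mem hS hs hs' hc hc')
    exact wordLT_wapp l' hv
  -- Both core words are prefixes of `w`, so one extends the other; the comparison of cores is then
  -- multiplied by the common right tail.
  rcases wapp_eq_wapp (e.symm.trans e') with ⟨n, rfl, rfl⟩ | ⟨n, rfl, rfl⟩
  · exact key hs hs' hc hc' e'
  · rw [← neg_sub]
    exact neg_mem (key hs' hs hc' hc e)

/-! ### The composition-diamond lemma -/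

/-- An element of a span of normal polynomials is `0` or already lies in the span of those whose
leading words are at most some word satisfying the same condition. -/
theorem exists_le_of_mem_normalSpan {P : FreeSemigroup X → Prop} {f : Lbs k p}
    (hf : f ∈ normalSpan deg S P) :
    f = 0 ∨ ∃ w, P w ∧ f ∈ normalSpan deg S (fun v => WordLT deg v w ∨ v = w) := by
  induction hf using Submodule.span_induction with
  | mem h hh =>
    obtain ⟨hn, v, hv, hP⟩ := hh
    exact Or.inr ⟨v, hP, Submodule.subset_span ⟨hn, v, hv, Or.inr rfl⟩⟩
  | zero => exact Or.inl rfl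
  | smul c f _ ih =>
    rcases ih with rfl | ⟨w, hw, h⟩
    · exact Or.inl (smul_zero c)
    · exact Or.inr ⟨w, hw, Submodule.smul_mem _ _ h⟩
  | add f g _ _ ihf ihg =>
    rcases ihf with rfl | ⟨w, hw, h⟩
    · rwa [zero_add]
    rcases ihg with rfl | ⟨w', hw', h'⟩
    · rw [add_zero]; exact Or.inr ⟨w, hw, h⟩
    have mono : ∀ {w w' : FreeSemigroup X}, WordLT deg w w' →
        normalSpan deg S (fun v => WordLT deg v w ∨ v = w) ≤
          normalSpan deg S (fun v => WordLT deg v w' ∨ v = w') := by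
      intro w w' hlt
      refine normalSpan_mono ?_
      rintro v (hv | rfl)
      · exact Or.inl (wordLT_trans hv hlt)
      · exact Or.inl hlt
    rcases wordLT_trichotomy (deg := deg) w w' with hlt | rfl | hlt
    · exact Or.inr ⟨w', hw', add_mem (mono hlt h) h'⟩
    · exact Or.inr ⟨w, hw, add_mem h h'⟩
    · exact Or.inr ⟨w, hw, add_mem h (mono hlt h')⟩

theorem normalSpan_le_wspan (hm : ∀ s ∈ S, IsMonic deg s) (w : FreeSemigroup X) :
    normalSpan deg S (fun v => WordLT deg v w) ≤ wspan k p (fun v => WordLT deg v w) := by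
  intro f hf
  refine map_mem_of_normalSpan hm LinearMap.id ?_ hf
  intro s _ g _ v hv hlt
  refine mem_wspan.2 fun u hu => ?_
  by_cases huv : u = v
  · exact huv ▸ hlt
  · exact wordLT_trans (hv.isLeading.2 u hu huv) hlt

/-- The leading monomial of a nonzero element of `Id(S)` is the leading monomial of a normal
`S`-polynomial, if `S` is a Gröbner-Shirshov basis. -/
theorem exists_normal_of_mem_idealSpan [WellFoundedLT X] (hS : IsGSBasis deg S) {f : Lbs k p}
    (hf : f ∈ idealSpan k S) {w : FreeSemigroup X} (hw : IsLeading deg f w) :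
    ∃ h, IsNormal deg S h ∧ IsLeading deg h w := by
  -- Well-founded induction on `u`, an upper bound for the leading words in a representation of `f`.
  have key : ∀ (u : FreeSemigroup X) (f : Lbs k p),
      f ∈ normalSpan deg S (fun v => WordLT deg v u ∨ v = u) → ∀ w, IsLeading deg f w →
        ∃ h, IsNormal deg S h ∧ IsLeading deg h w := by
    intro u
    induction u using (wordLT_wf (X := X) (deg := deg)).induction with
    | _ u ih =>
    intro f hf w hw
    have small : f ∈ normalSpan deg S (fun v => WordLT deg v u) →
        ∃ h, IsNormal deg S h ∧ IsLeading deg h w := by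
      intro h
      rcases exists_le_of_mem_normalSpan h with h0 | ⟨u', hu', h'⟩
      · exact absurd h0 hw.ne_zero
      · exact ih u' hu' f h' w hw
    by_cases hex : ∃ s ∈ S, ∃ h, IsNormalOf deg s h ∧ IsLeading deg h u
    · obtain ⟨s, hs, h, hh, hu⟩ := hex
      -- All normal polynomials with leading word `u` agree with `h` modulo smaller ones, so they
      -- can be collected into one multiple of `h`. If `c = 0` the bound drops; otherwise `u` is the
      -- leading word of `f`.
      have hsplit : ∃ c : k, f - c • h ∈ normalSpan deg S (fun v => WordLT deg v u) := by
        have : normalSpan deg S (fun v => WordLT deg v u ∨ v = u) ≤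
            (k ∙ h) ⊔ normalSpan deg S (fun v => WordLT deg v u) := by
          intro g hgu
          refine map_mem_of_normalSpan hS.monic LinearMap.id ?_ hgu
          rintro s' hs' g hg v hv (hlt | rfl)
          · exact Submodule.mem_sup_right (hg.mem_normalSpan hs' hv hlt)
          · rw [LinearMap.id_apply, ← add_sub_cancel h g]
            exact Submodule.add_mem_sup (Submodule.mem_span_singleton_self h)
              (normal_sub_normal_mem hS hs' hs hg hh hv.isLeading hu)
        obtain ⟨y, hy, z, hz, e⟩ := Submodule.mem_sup.1 (this hf)
        obtain ⟨c, rfl⟩ := Submodule.mem_span_singleton.1 hy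
        exact ⟨c, by rwa [← e, add_sub_cancel_left]⟩
      obtain ⟨c, hc⟩ := hsplit
      by_cases hc0 : c = 0
      · rw [hc0, zero_smul, sub_zero] at hc
        exact small hc
      · have hh1 := (hh.isMonic (hS.monic s hs)).hasMonicLead hu
        have hfu : HasMonicLead deg (c⁻¹ • f) u := by
          have e : c⁻¹ • f - nf k p u = c⁻¹ • (f - c • h) + (h - nf k p u) := by
            rw [smul_sub, inv_smul_smul₀ hc0]; abel
          rw [HasMonicLead, e]
          exact add_mem (Submodule.smul_mem _ _ (normalSpan_le_wspan hS.monic u hc)) hh1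
        have hsupp : ∀ v, v ∈ supp (c⁻¹ • f) ↔ v ∈ supp f := by
          intro v
          simp [mem_supp, hc0]
        have hl := hfu.isLeading
        have hlf : IsLeading deg f u :=
          ⟨(hsupp u).1 hl.1, fun v hv => hl.2 v ((hsupp v).2 hv)⟩
        rw [hw.unique hlf]
        exact ⟨h, ⟨s, hs, hh⟩, hu⟩
    · refine small (Submodule.span_mono ?_ hf)
      rintro h ⟨⟨s, hs, hh⟩, v, hv, hlt | rfl⟩
      · exact ⟨⟨s, hs, hh⟩, v, hv, hlt⟩
      · exact absurd ⟨s, hs, h, hh, hv⟩ hex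
  rw [idealSpan_eq_normalSpan hS] at hf
  rcases exists_le_of_mem_normalSpan hf with h0 | ⟨u, -, hu⟩
  · exact absurd h0 hw.ne_zero
  · exact key u f hu w hw

end Normal

/-! ## Leading words of an ideal -/

section Reduced

variable {k X : Type*} [Field k] [LinearOrder X] {p : X → ZMod 2} {deg : X → ℕ}

variable (deg) in
/-- The words `w` such that `[w]_L` is the leading monomial of an element of `I`. -/
def leadSet (I : Submodule k (Lbs k p)) : Set (FreeSemigroup X) :=
  {w | ∃ f ∈ I, IsLeading deg f w}

variable (deg) in
/-- The words of `leadSet deg I` that do not arise from smaller ones by forming normal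
polynomials. -/
def IsMinLead (I : Submodule k (Lbs k p)) (w : FreeSemigroup X) : Prop :=
  w ∈ leadSet deg I ∧ (∀ v l, w = wapp v l → v ∈ leadSet deg I → l = []) ∧
    ∀ u x l, w = wapp (u * FreeSemigroup.of x) l → FreeSemigroup.of x ∉ leadSet deg I

variable (deg) in
/-- The span of the monomials smaller than `[w]_L` that are not leading monomials of elements
of `I`. -/
def restSpan (I : Submodule k (Lbs k p)) (w : FreeSemigroup X) : Submodule k (Lbs k p) :=
  wspan k p (fun v => WordLT deg v w ∧ v ∉ leadSet deg I)

variable (deg) in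
/-- The monic elements of `I` with minimal leading words, all of whose other monomials are in
normal form modulo `I`. -/
def reducedSet (I : Submodule k (Lbs k p)) : Set (Lbs k p) :=
  {s | s ∈ I ∧ ∃ w, IsMinLead deg I w ∧ s - nf k p w ∈ restSpan deg I w}

variable {I : Submodule k (Lbs k p)}

/-! ### Division with remainder modulo an ideal -/

theorem hasMonicLead_of_restSpan {s : Lbs k p} {w : FreeSemigroup X}
    (h : s - nf k p w ∈ restSpan deg I w) : HasMonicLead deg s w :=
  wspan_mono (fun _ hv => hv.1) h

theorem eq_zero_of_mem_restSpan {f : Lbs k p} {w : FreeSemigroup X} (hI : f ∈ I)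
    (h : f ∈ restSpan deg I w) : f = 0 := by
  by_contra h0
  obtain ⟨v, hv⟩ := exists_isLeading (deg := deg) h0
  exact (mem_wspan.1 h v hv.1).2 ⟨f, hI, hv⟩

theorem eq_of_sub_mem_restSpan {f g : Lbs k p} {w : FreeSemigroup X} (hf : f ∈ I) (hg : g ∈ I)
    (hfw : f - nf k p w ∈ restSpan deg I w) (hgw : g - nf k p w ∈ restSpan deg I w) : f = g := by
  have := sub_mem hfw hgw
  rw [sub_sub_sub_cancel_right] at this
  exact sub_eq_zero.1 (eq_zero_of_mem_restSpan (sub_mem hf hg) this)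

/-- By well-founded induction, a leading word `v` below `w` is replaced, modulo `I`, by the lower
monomials of an element of `I` with leading word `v`. -/
theorem wspan_le_restSpan_sup [WellFoundedLT X] (I : Submodule k (Lbs k p))
    (w : FreeSemigroup X) : wspan k p (fun v => WordLT deg v w) ≤ restSpan deg I w ⊔ I := by
  induction w using (wordLT_wf (X := X) (deg := deg)).induction with
  | _ w ih =>
  refine wspan_le fun v hv => ?_
  by_cases hl : v ∈ leadSet deg I
  · obtain ⟨f, hf, hfv⟩ := hl
    have h1 := ih v hv hfv.hasMonicLead
    have h2 : restSpan deg I v ⊔ I ≤ restSpan deg I w ⊔ I :=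
      sup_le_sup_right (wspan_mono fun u hu => ⟨wordLT_trans hu.1 hv, hu.2⟩) I
    have h3 := sub_mem (Submodule.mem_sup_right (Submodule.smul_mem I ((nfBasis k p).repr f v)⁻¹ hf)) (h2 h1)
    rwa [sub_sub_cancel] at h3
  · exact Submodule.mem_sup_left (nf_mem_wspan ⟨hv, hl⟩)

theorem exists_reduced [WellFoundedLT X] {w : FreeSemigroup X} (hw : w ∈ leadSet deg I) :
    ∃ s ∈ I, s - nf k p w ∈ restSpan deg I w := by
  obtain ⟨f, hf, hfw⟩ := hw
  obtain ⟨b, hb, g, hg, e⟩ := Submodule.mem_sup.1 (wspan_le_restSpan_sup I w hfw.hasMonicLead)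
  refine ⟨_, sub_mem (Submodule.smul_mem I ((nfBasis k p).repr f w)⁻¹ hf) hg, ?_⟩
  have : ((nfBasis k p).repr f w)⁻¹ • f - g - nf k p w = b := by
    rw [sub_right_comm, ← e, add_sub_cancel_right]
  rwa [this]

/-- Projecting `s` to the parity of `w` stays in `I`, keeps `w` and only deletes other monomials;
uniqueness of the reduced element forces the projection to be `s`. -/
theorem isHomogeneous_of_restSpan (hI : IsGradedIdeal I) {s : Lbs k p} {w : FreeSemigroup X}
    (hs : s ∈ I) (h : s - nf k p w ∈ restSpan deg I w) : IsHomogeneous s := by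
  refine isHomogeneous_iff.2 ⟨wordParity p w, ?_⟩
  have h1 : partProj k p (wordParity p w) s - nf k p w ∈ restSpan deg I w := by
    have := map_mem_of_wspan (N := restSpan deg I w) (partProj k p (wordParity p w))
      (fun u hu => by
        rw [partProj_nf]
        split_ifs
        · exact nf_mem_wspan hu
        · exact zero_mem _) h
    rwa [map_sub, partProj_nf, if_pos rfl] at this
  rw [eq_of_sub_mem_restSpan hs (partProj_mem_ideal hI _ hs) h h1]
  exact partProj_mem_part _ s

/-! ### The reduced set is a Gröbner-Shirshov basis -/

/-- The leading word of a normal polynomial extends the leading word of its generator. -/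
theorem IsNormalOf.lead_cases {s h : Lbs k p} {v w : FreeSemigroup X}
    (hs : HasMonicLead deg s v) (hh : IsNormalOf deg s h) (hw : IsLeading deg h w) :
    (∃ l, w = wapp v l ∧ h = LeibnizGS.rmul s l) ∨
      ∃ u x l, v = FreeSemigroup.of x ∧ w = wapp (u * FreeSemigroup.of x) l := by
  obtain ⟨c, q, l, hc, rfl⟩ := hh.exists_isCore hs.isMonic
  have hwl := hw.unique (hc.hasMonicLead.rmul l).isLeading
  rcases hc with ⟨rfl, hq⟩ | ⟨x, u, hx, rfl, rfl⟩
  · obtain rfl := hs.isLeading.unique hq.isLeading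
    exact Or.inl ⟨l, hwl, rfl⟩
  · exact Or.inr ⟨u, x, l, hs.isLeading.unique hx.isLeading, hwl⟩

/-- A minimal leading word is the leading word of the generator of any normal polynomial of `I`
that has it as its leading word. -/
theorem IsMinLead.eq_of_isNormalOf {s h : Lbs k p} {v w : FreeSemigroup X}
    (hw : IsMinLead deg I w) (hsI : s ∈ I) (hs : HasMonicLead deg s v)
    (hh : IsNormalOf deg s h) (hlead : IsLeading deg h w) : w = v := by
  have hv : v ∈ leadSet deg I := ⟨s, hsI, hs.isLeading⟩
  rcases hh.lead_cases hs hlead with ⟨l, rfl, -⟩ | ⟨u, x, l, rfl, e⟩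
  · rw [hw.2.1 v l rfl hv, wapp_nil]
  · exact absurd hv (hw.2.2 u x l e)

theorem isMinLead_of (x : X) (h : FreeSemigroup.of x ∈ leadSet deg I) :
    IsMinLead deg I (FreeSemigroup.of x) := by
  refine ⟨h, fun v l e _ => ?_, fun u y l e => ?_⟩
  · have h1 := congrArg FreeSemigroup.length e
    rw [length_of, length_wapp] at h1
    have := one_le_length v
    exact List.length_eq_zero_iff.1 (by omega)
  · have h1 := congrArg FreeSemigroup.length e
    rw [length_of, length_wapp, FreeSemigroup.length_mul] at h1
    have := one_le_length u
    have := one_le_length (FreeSemigroup.of y)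
    omega

/-- Every leading word of `I` arises from a minimal one. -/
theorem exists_isCore_of_mem_leadSet [WellFoundedLT X] {w : FreeSemigroup X}
    (hw : w ∈ leadSet deg I) :
    ∃ s ∈ reducedSet deg I, ∃ c q l, IsCore deg s c q ∧ w = wapp q l := by
  obtain ⟨n, hn⟩ : ∃ n, w.length = n := ⟨_, rfl⟩
  induction n using Nat.strong_induction_on generalizing w with
  | _ n ih =>
  by_cases hmin : IsMinLead deg I w
  · obtain ⟨s, hs, h⟩ := exists_reduced hw
    exact ⟨s, ⟨hs, w, hmin, h⟩, s, w, [], Or.inl ⟨rfl, hasMonicLead_of_restSpan h⟩,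
      (wapp_nil w).symm⟩
  · rw [IsMinLead, not_and_or, not_and_or] at hmin
    rcases hmin with h | h | h
    · exact absurd hw h
    · push Not at h
      obtain ⟨v, l, rfl, hv, hl⟩ := h
      have hlt : v.length < n := by
        rw [← hn, length_wapp]
        have := List.length_pos_iff.2 hl
        omega
      obtain ⟨s, hs, c, q, m, hc, rfl⟩ := ih _ hlt hv rfl
      exact ⟨s, hs, c, q, m ++ l, hc, wapp_wapp _ _ _⟩
    -- A leading letter after the first position is a minimal word, and the prefix `u` is absorbed
    -- into the core.
    · push Not at h
      obtain ⟨u, x, l, rfl, hx⟩ := h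
      obtain ⟨s, hs, h⟩ := exists_reduced hx
      exact ⟨s, ⟨hs, _, isMinLead_of x hx, h⟩, _, _, l,
        Or.inr ⟨x, u, hasMonicLead_of_restSpan h, rfl, rfl⟩, rfl⟩

theorem reducedSet_isMonic {s : Lbs k p} (hs : s ∈ reducedSet deg I) : IsMonic deg s := by
  obtain ⟨-, w, -, h⟩ := hs
  exact (hasMonicLead_of_restSpan h).isMonic

/-- Every element of `I` is a combination of normal polynomials whose leading words are not
larger than that of the element. -/
theorem mem_normalSpan_reducedSet [WellFoundedLT X] (hI : IsIdeal I) {w : FreeSemigroup X}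
    {f : Lbs k p} (hf : f ∈ I) (hw : IsLeading deg f w) :
    f ∈ normalSpan deg (reducedSet deg I) (fun v => WordLT deg v w ∨ v = w) := by
  induction w using (wordLT_wf (X := X) (deg := deg)).induction generalizing f with
  | _ w ih =>
  obtain ⟨s, hs, c, q, l, hc, rfl⟩ := exists_isCore_of_mem_leadSet ⟨f, hf, hw⟩
  have hn := hc.isNormalOf l
  have hm := hc.hasMonicLead.rmul l
  generalize wapp q l = w at *
  generalize LeibnizGS.rmul c l = h at *
  set a := (nfBasis k p).repr f w with ha
  have ha0 : a ≠ 0 := mem_supp.1 hw.1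
  have hg := hw.hasMonicLead.sub_mem hm
  have hgI : a⁻¹ • f - h ∈ I :=
    sub_mem (Submodule.smul_mem I _ hf) (hn.mem_ideal hI hs.1)
  have hN : a⁻¹ • f - h ∈
      normalSpan deg (reducedSet deg I) (fun v => WordLT deg v w ∨ v = w) := by
    by_cases h0 : a⁻¹ • f - h = 0
    · rw [h0]; exact zero_mem _
    obtain ⟨u, hu⟩ := exists_isLeading (deg := deg) h0
    have huw := mem_wspan.1 hg u hu.1
    refine normalSpan_mono (fun v hv => Or.inl ?_) (ih u huw hgI hu)
    rcases hv with hv | rfl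
    · exact wordLT_trans hv huw
    · exact huw
  have e : f = a • ((a⁻¹ • f - h) + h) := by rw [sub_add_cancel, smul_inv_smul₀ ha0]
  rw [e]
  exact Submodule.smul_mem _ _ (add_mem hN (hn.mem_normalSpan hs hm (Or.inr rfl)))

/-- Downward closed conditions cover every bound needed: below a word for inclusions, bounded degree
for left multiplications, and no bound for generating `I`. -/
theorem mem_normalSpan_of_mem_wspan [WellFoundedLT X] (hI : IsIdeal I)
    {P : FreeSemigroup X → Prop} (hP : ∀ u v, WordLT deg u v → P v → P u) {f : Lbs k p}
    (hf : f ∈ I) (hfP : f ∈ wspan k p P) : f ∈ normalSpan deg (reducedSet deg I) P := by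
  by_cases h0 : f = 0
  · rw [h0]; exact zero_mem _
  obtain ⟨w, hw⟩ := exists_isLeading (deg := deg) h0
  have hPw := mem_wspan.1 hfP w hw.1
  refine normalSpan_mono ?_ (mem_normalSpan_reducedSet hI hf hw)
  rintro v (hv | rfl)
  · exact hP v w hv hPw
  · exact hPw

/-- No composition has to be computed: each lies in `I`, and its monomials already satisfy the
required bound. -/
theorem reducedSet_isGSBasis [WellFoundedLT X] (hI : IsGradedIdeal I) :
    IsGSBasis deg (reducedSet deg I) where
  monic _ := reducedSet_isMonic
  homogeneous f hf := by
    obtain ⟨hfI, w, -, h⟩ := hf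
    exact isHomogeneous_of_restSpan hI hfI h
  inclusion f hf g hg _ h w hh hfw hhw :=
    mem_normalSpan_of_mem_wspan hI.1 (fun _ _ => wordLT_trans)
      (sub_mem hf.1 (hh.mem_ideal hI.1 hg.1))
      (((reducedSet_isMonic hf).hasMonicLead hfw).sub_mem
        ((hh.isMonic (reducedSet_isMonic hg)).hasMonicLead hhw))
  leftMul f hf w hw _ u _ := by
    refine mem_normalSpan_of_mem_wspan (P := fun v => wordDeg deg v ≤ wordDeg deg u + wordDeg deg w)
      hI.1 (fun _ _ h h' => (wordDeg_le_of_wordLT h).trans h')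
      (hI.1 _ _ hf.1).1 ?_
    have hfw : f ∈ wspan k p (fun v => wordDeg deg v ≤ wordDeg deg w) := by
      refine mem_wspan.2 fun v hv => ?_
      by_cases hvw : v = w
      · rw [hvw]
      · exact wordDeg_le_of_wordLT (hw.2 v hv hvw)
    refine mul_mem_of_wspan_right _ (fun v hv => ?_) hfw
    refine wspan_mono (fun v' hv' => ?_) (nf_mul_nf_mem deg v u)
    omega

theorem reducedSet_isReducedGSBasisFor [WellFoundedLT X] (hI : IsGradedIdeal I) :
    IsReducedGSBasisFor deg (reducedSet deg I) I := by
  refine ⟨le_antisymm ?_ (idealSpan_le hI.1 fun s hs => hs.1), reducedSet_isGSBasis hI, ?_⟩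
  · intro f hf
    rw [idealSpan_eq_normalSpan (reducedSet_isGSBasis hI)]
    exact mem_normalSpan_of_mem_wspan hI.1 (fun _ _ _ h => h) hf (mem_wspan_true f)
  · rintro s ⟨hsI, w, hw, h⟩ u hu g ⟨t, ⟨⟨htI, v, hv, ht⟩, hts⟩, hg⟩ hgu
    have hlead := hasMonicLead_of_restSpan h
    by_cases huw : u = w
    -- Minimality of the leading word gives `t` the same leading word as `s`, so `t = s` by
    -- uniqueness. The remaining monomials of `s` are not leading words of `I` at all.
    · subst huw
      obtain rfl := hw.eq_of_isNormalOf htI (hasMonicLead_of_restSpan ht) hg hgu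
      exact hts (eq_of_sub_mem_restSpan htI hsI ht h)
    · have hu' : u ∈ supp (s - nf k p w) := by
        rw [SetLike.mem_coe, mem_supp] at hu
        rw [mem_supp, map_sub, repr_nf, Finsupp.sub_apply, Finsupp.single_eq_of_ne huw, sub_zero]
        exact hu
      exact (mem_wspan.1 h u hu').2 ⟨g, hg.mem_ideal hI.1 htI, hgu⟩

/-! ### Uniqueness -/

/-- Reducedness compares `s` only with `S \ {s}`; this excludes that `s` reduces one of its own
lower monomials. -/
theorem IsNormalOf.not_wordLT {s h : Lbs k p} {v w : FreeSemigroup X}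
    (hdeg : ∀ x, 0 < deg x) (hs : HasMonicLead deg s v) (hh : IsNormalOf deg s h)
    (hw : IsLeading deg h w) : ¬ WordLT deg w v := by
  rcases hh.lead_cases hs hw with ⟨l, rfl, -⟩ | ⟨u, x, l, rfl, rfl⟩
  · exact not_wordLT_wapp v l
  · intro h
    exact not_wordLT_wapp _ l (wordLT_trans h (wordLT_mul_of_self hdeg u x))

theorem IsReducedGSBasisFor.eq_reducedSet [WellFoundedLT X] (hdeg : ∀ x, 0 < deg x)
    {S : Set (Lbs k p)} (hS : IsReducedGSBasisFor deg S I) : S = reducedSet deg I := by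
  obtain ⟨rfl, hGS, hred⟩ := hS
  have hI : IsIdeal (idealSpan k S) := isIdeal_idealSpan S
  have hsub : S ⊆ idealSpan k S := subset_idealSpan S
  -- The composition-diamond lemma, together with the leading word of the generator.
  have exists_normal : ∀ {v}, v ∈ leadSet deg (idealSpan k S) →
      ∃ t ∈ S, ∃ q, HasMonicLead deg t q ∧ ∃ g, IsNormalOf deg t g ∧ IsLeading deg g v := by
    rintro v ⟨f, hf, hfv⟩
    obtain ⟨g, ⟨t, ht, hg⟩, hgv⟩ := exists_normal_of_mem_idealSpan hGS hf hfv
    obtain ⟨q, hq, -⟩ := id (hGS.monic t ht)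
    exact ⟨t, ht, q, (hGS.monic t ht).hasMonicLead hq, g, hg, hgv⟩
  have min : ∀ s ∈ S, ∀ w, HasMonicLead deg s w → IsMinLead deg (idealSpan k S) w := by
    intro s hs w hw
    have irr : ∀ t ∈ S, ∀ g, IsNormalOf deg t g → IsLeading deg g w → t = s := by
      intro t ht g hg hgw
      by_contra hne
      exact hred s hs hw.isLeading.1 g ⟨t, ⟨ht, hne⟩, hg⟩ hgw
    refine ⟨⟨s, hsub hs, hw.isLeading⟩, ?_, ?_⟩
    · rintro v l rfl hv
      obtain ⟨t, ht, q, hq, g, hg, hgv⟩ := exists_normal hv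
      have hgm := (hg.isMonic (hGS.monic t ht)).hasMonicLead hgv
      -- Extending `g` by `l` gives a normal polynomial with the leading word of `s`, so its
      -- generator is `s`. As `v` is then a leading word of a normal polynomial built from `s`, it
      -- is no shorter than `v l`.
      obtain rfl := irr t ht _ (hg.rmul l) (hgm.rmul l).isLeading
      obtain rfl := hw.isLeading.unique hq.isLeading
      have hlen : (wapp v l).length ≤ v.length := by
        rcases hg.lead_cases hq hgv with ⟨m, e, -⟩ | ⟨u, x, m, e, e'⟩
        · have := congrArg FreeSemigroup.length e
          rw [length_wapp (wapp v l)] at this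
          omega
        · rw [e, length_of]
          exact one_le_length v
      rw [length_wapp] at hlen
      exact List.length_eq_zero_iff.1 (by omega)
    · rintro u x l rfl hx
      obtain ⟨t, ht, q, hq, g, hg, hgx⟩ := exists_normal hx
      obtain rfl := (isMinLead_of x hx).eq_of_isNormalOf (hsub ht) hq hg hgx
      have hcore : IsCore deg t (nf k p u * t) (u * FreeSemigroup.of x) :=
        Or.inr ⟨x, u, hq, rfl, rfl⟩
      -- The generator `t` has leading word `x`, and `[u t l]_L` has the leading word of `s`. Hence
      -- `t = s`, which would have both a letter and a longer word as leading word.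
      obtain rfl := irr t ht _ (hcore.isNormalOf l) (hcore.hasMonicLead.rmul l).isLeading
      have e := congrArg FreeSemigroup.length (hw.isLeading.unique hq.isLeading)
      rw [length_wapp, FreeSemigroup.length_mul, length_of] at e
      have := one_le_length u
      omega
  have rest : ∀ s ∈ S, ∀ w, HasMonicLead deg s w →
      s - nf k p w ∈ restSpan deg (idealSpan k S) w := by
    intro s hs w hw
    refine mem_wspan.2 fun v hv => ?_
    have hlt := mem_wspan.1 hw v hv
    refine ⟨hlt, fun hl => ?_⟩
    obtain ⟨t, ht, q, hq, g, hg, hgv⟩ := exists_normal hl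
    have hvs : v ∈ supp s := by
      have hne : v ≠ w := by rintro rfl; exact wordLT_irrefl v hlt
      rw [mem_supp, map_sub, repr_nf, Finsupp.sub_apply, Finsupp.single_eq_of_ne hne,
        sub_zero] at hv
      exact mem_supp.2 hv
    by_cases hts : t = s
    · subst hts
      exact hg.not_wordLT hdeg hw hgv hlt
    · exact hred s hs hvs g ⟨t, ⟨ht, hts⟩, hg⟩ hgv
  apply Set.Subset.antisymm
  · intro s hs
    obtain ⟨w, hw, -⟩ := id (hGS.monic s hs)
    have hw' := (hGS.monic s hs).hasMonicLead hw
    exact ⟨hsub hs, w, min s hs w hw', rest s hs w hw'⟩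
  · rintro s ⟨hsI, w, hw, h⟩
    -- Minimality of `w` makes it the leading word of the generator `t` itself; `t` and `s` are then
    -- reduced with the same leading word, hence equal.
    obtain ⟨t, ht, q, hq, g, hg, hgw⟩ := exists_normal hw.1
    obtain rfl := hw.eq_of_isNormalOf (hsub ht) hq hg hgw
    rwa [eq_of_sub_mem_restSpan hsI (hsub ht) h (rest t ht w hq)]

theorem existsUnique_isReducedGSBasisFor [WellFoundedLT X] (hdeg : ∀ x, 0 < deg x)
    (hI : IsGradedIdeal I) : ∃! S : Set (Lbs k p), IsReducedGSBasisFor deg S I :=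
  ⟨_, reducedSet_isReducedGSBasisFor hI, fun _ hS => hS.eq_reducedSet hdeg⟩

end Reduced

end

end LeibnizGS

theorem mainTheorem3 {k X : Type*} [Field k] [LinearOrder X] [WellFoundedLT X]
    (p : X → ZMod 2) (deg : X → ℕ) (hdeg : ∀ x, 0 < deg x) :
    (∀ I : Submodule k (LeibnizGS.Lbs k p), LeibnizGS.IsGradedIdeal I →
      ∃! S : Set (LeibnizGS.Lbs k p), LeibnizGS.IsReducedGSBasisFor deg S I) ∧
    (∀ (I J : Submodule k (LeibnizGS.Lbs k p)) (SI SJ : Set (LeibnizGS.Lbs k p)),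
      LeibnizGS.IsGradedIdeal I → LeibnizGS.IsGradedIdeal J →
      LeibnizGS.IsReducedGSBasisFor deg SI I → LeibnizGS.IsReducedGSBasisFor deg SJ J →
      (I = J ↔ SI = SJ)) ∧
    ((∀ x, p x = 0) → ∀ I : Submodule k (LeibnizGS.Lbs k p), LeibnizGS.IsIdeal I →
      LeibnizGS.IsGradedIdeal I ∧
        ∃! S : Set (LeibnizGS.Lbs k p), LeibnizGS.IsReducedGSBasisFor deg S I) := by
  refine ⟨fun I hI => LeibnizGS.existsUnique_isReducedGSBasisFor hdeg hI, ?_, fun hp I hI =>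
    ⟨hI.isGradedIdeal hp,
      LeibnizGS.existsUnique_isReducedGSBasisFor hdeg (hI.isGradedIdeal hp)⟩⟩
  intro I J SI SJ _ _ hSI hSJ
  constructor
  · rintro rfl
    rw [hSI.eq_reducedSet hdeg, hSJ.eq_reducedSet hdeg]
  · rintro rfl
    rw [hSI.1, hSJ.1]
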